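/- **Notation.** Let $w(z)=e^{-z^2}\operatorname{erfc}(-iz)$ be the Faddeeva function, where $\operatorname{erfc}(z)=\frac{2}{\sqrt\pi}\int_z^\infty e^{-t^2}\,dt$. For $h>0$ and $\alpha\in[0,1)$ put $$I_{h,\alpha}[f]:=h\sum_{k\in\mathbb Z}f((k-\alpha)h),\qquad g(\zeta):=i\cot\bigl(\pi(\alpha+\zeta/h)\bigr).$$ For $H>0$ and $f$ with finitely many poles $\zeta_1,\dots,\zeta_m$ in the strip $|\operatorname{Im}\zeta|<H$, all simple and off the real line, put $$I^*_{h,\alpha,H}[f]:=I_{h,\alpha}[f]+\pi i\sum_{k=1}^m\bigl(\operatorname{sign}(\operatorname{Im}\zeta_k)-g(\zeta_k)\bigr)\operatorname{Res}(f,\zeta_k).$$ Let $$f_z(t):=e^{-t^2}\,\frac{iz}{\pi(z^2-t^2)} .$$ For $\operatorname{Im}z>0$ let $I^*_{h,\alpha}[f_z]:=\lim_{H\to\infty}I^*_{h,\alpha,H}[f_z]$. As a function of $z$ this extends to an entire function, and $I^*_{h,\alpha}[f_z]$ denotes the value of that extension for all other $z$, in particular for real $z$. **Proposition.** Let $0<h<\sqrt2\,\pi$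 and $\alpha\in[0,1)$. Then the entire extension above exists, and for all $z=x+iy$ with $0\le y\le x$ we have $w(z)\neq0$, $$\bigl|w(z)-I^*_{h,\alpha}[f_z]\bigr|\le c_a\,\frac{e^{-\pi^2/h^2}}{1-e^{-2\pi^2/h^2+\sqrt2\,\pi/h}} \qquad\text{and}\qquad \frac{\bigl|w(z)-I^*_{h,\alpha}[f_z]\bigr|}{|w(z)|}\le\frac{c_r}{h}\,\frac{e^{-\pi^2/h^2}}{1-e^{-2\pi^2/h^2+\sqrt2\,\pi/h}},$$ where $$c_a=\frac{2(2e+\sqrt\pi)}{\sqrt{e\pi}}\ (\approx 4.934),\qquad c_r=\frac{2\sqrt{2\pi}\,(1+\sqrt\pi)(2e+\sqrt\pi)}{\sqrt e}\ (\approx 60.77).$$ -/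

import Mathlib

open Filter Topology

noncomputable section

/-- The complementary error function `(2/√π) ∫_z^∞ e^{-t²} dt` of a complex argument; the path of
integration is the horizontal half-line `t = z + s`, `s > 0`. -/
def cerfc (z : ℂ) : ℂ :=
  2 / (Real.sqrt Real.pi : ℂ) * ∫ s in Set.Ioi (0 : ℝ), Complex.exp (-(z + (s : ℂ)) ^ 2)

/-- The Faddeeva function `w(z) = e^{-z²} erfc(-iz)`. -/
def faddeeva (z : ℂ) : ℂ := Complex.exp (-z ^ 2) * cerfc (-Complex.I * z)

/-- The generalised trapezoidal rule `I_{h,α}[f] = h ∑_{k ∈ ℤ} f((k - α) h)`. -/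
def trapRule (h α : ℝ) (f : ℂ → ℂ) : ℂ :=
  (h : ℂ) * ∑' k : ℤ, f ((((k : ℝ) - α) * h : ℝ) : ℂ)

/-- The function `g(ζ) = i cot(π(α + ζ/h))`. -/
def cotKernel (h α : ℝ) (ζ : ℂ) : ℂ :=
  Complex.I * Complex.cot ((Real.pi : ℂ) * ((α : ℂ) + ζ / (h : ℂ)))

/-- The poles of `f` in the open strip `|Im ζ| < H`. -/
def stripPoles (H : ℝ) (f : ℂ → ℂ) : Set ℂ :=
  {ζ | |ζ.im| < H ∧ MeromorphicAt f ζ ∧ meromorphicOrderAt f ζ < 0}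

/-- The residue `lim_{ζ → p} (ζ - p) f(ζ)` of `f` at a simple pole `p`. -/
def simpleResidue (f : ℂ → ℂ) (p : ℂ) : ℂ :=
  limUnder (𝓝[≠] p) (fun ζ => (ζ - p) * f ζ)

/-- The correction term `C_{h,α,H}[f] = π i ∑ₖ (sign(Im ζₖ) - g(ζₖ)) Res(f, ζₖ)`, the sum being
over the poles `ζₖ` of `f` in the strip `|Im ζ| < H`. -/
def trapCorrection (h α H : ℝ) (f : ℂ → ℂ) : ℂ :=
  (Real.pi : ℂ) * Complex.I *
    ∑ᶠ ζ ∈ stripPoles H f,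
      (((Real.sign ζ.im : ℝ) : ℂ) - cotKernel h α ζ) * simpleResidue f ζ

/-- The modified generalised trapezoidal rule `I*_{h,α,H}[f] = I_{h,α}[f] + C_{h,α,H}[f]`. -/
def modTrapRule (h α H : ℝ) (f : ℂ → ℂ) : ℂ :=
  trapRule h α f + trapCorrection h α H f

/-- The integrand `f_z(t) = e^{-t²} i z / (π (z² - t²))`. -/
def faddeevaIntegrand (z t : ℂ) : ℂ :=
  Complex.exp (-t ^ 2) * (Complex.I * z / ((Real.pi : ℂ) * (z ^ 2 - t ^ 2)))

/-- `J` is the function `z ↦ I*_{h,α}[f_z]`: it is given by `lim_{H → ∞} I*_{h,α,H}[f_z]` for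
`Im z > 0` and is continued analytically to the whole plane, in particular to the real line, where
`f_z` has poles on the path of integration. There is at most one such `J`. -/
def IsModTrapFaddeeva (h α : ℝ) (J : ℂ → ℂ) : Prop :=
  Differentiable ℂ J ∧
    ∀ z : ℂ, 0 < z.im →
      Tendsto (fun H : ℝ => modTrapRule h α H (faddeevaIntegrand z)) atTop (𝓝 (J z))

/-- `c_a = 2(2e + √π)/√(eπ)`, about `4.934`. -/
def cAbs : ℝ :=
  2 * (2 * Real.exp 1 + Real.sqrt Real.pi) / Real.sqrt (Real.exp 1 * Real.pi)

/-- `c_r = 2√(2π)(1 + √π)(2e + √π)/√e`, about `60.77`. -/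
def cRel : ℝ :=
  2 * Real.sqrt (2 * Real.pi) * (1 + Real.sqrt Real.pi) *
    (2 * Real.exp 1 + Real.sqrt Real.pi) / Real.sqrt (Real.exp 1)

/-- The factor `e^{-π²/h²} / (1 - e^{-2π²/h² + √2 π/h})`. -/
def trapErrFactor (h : ℝ) : ℝ :=
  Real.exp (-Real.pi ^ 2 / h ^ 2) /
    (1 - Real.exp (-2 * Real.pi ^ 2 / h ^ 2 + Real.sqrt 2 * Real.pi / h))

end

open MeasureTheory Set

/-! ### Gaussian integrals on a half-line -/

/-! For `Im z > 0`, partial fractions split `f_z(t)` into multiples of `1/(z + t)` and `1/(z - t)`,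
and `i/(2(z + t)) = ∫_0^∞ e^{2i(z+t)s} ds`. Poisson summation under this integral turns the
trapezoidal sum into `∑_{n ∈ ℤ} cos(2πnα) e^{-b_n²} w(z - i b_n)` with `b_n = πn/h`
(`hasSum_trapMode`). The mode `n = 0` is `w(z)`. For `n ≥ 1` the reflection formula `w(ζ) + w(-ζ) =
2e^{-ζ²}` extracts an exponential from `w(z - i b_n)`, and these exponentials are cancelled by the
geometric expansion of the cotangent correction. What remains (`modTrapRule_eq`) is `w(z) + ∑_{n ≥
1} cos(2πnα) e^{-b_n²} (w(z + i b_n) - w(i b_n - z))`, which converges locally uniformly on the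
plane and so is the entire extension.

In the sector each bracket is at most `4`, and at most a constant over `√π (x + 3/5)`
(`norm_faddeeva_sub_le`), because `|w| ≤ 1` and `|z w| ≤ 2/√π` in the closed upper half-plane. The
Gaussian weights are dominated by a geometric series with sum `trapErrFactor h`.

The relative bound also needs `|w(z)| ≥ 1/(√(2π) (x + 3/5))` in the sector
(`one_le_mul_norm_faddeeva`). This follows by comparing `Re(√π (1 - i) w)` with an explicit harmonic
function, on the axes through `w' = -2zw + 2i/√π` and inside the quadrant through Phragmén–Lindelöf.
-/

lemma integrable_exp_neg_sq_add (c : ℝ) :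
    Integrable (fun s : ℝ => Real.exp (-s ^ 2 + c * s)) := by
  have := (integrable_cexp_quadratic' (b := -1) (by simp) (c : ℂ) 0).norm
  refine this.congr (ae_of_all _ fun s => ?_)
  simp only [Complex.norm_exp]
  congr 1
  rw [show (-1 : ℂ) * (s : ℂ) ^ 2 + (c : ℂ) * (s : ℂ) + 0 = ((-s ^ 2 + c * s : ℝ) : ℂ) by
    push_cast; ring, Complex.ofReal_re]

lemma integrable_cexp_neg_sq_add (c : ℂ) :
    Integrable (fun s : ℝ => Complex.exp (-(s : ℂ) ^ 2 + c * s)) := by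
  refine (integrable_cexp_quadratic' (b := -1) (by simp) c 0).congr (ae_of_all _ fun s => ?_)
  simp

lemma norm_cexp_neg_sq_add (z : ℂ) (s : ℝ) :
    ‖Complex.exp (-(s : ℂ) ^ 2 + 2 * Complex.I * z * s)‖ = Real.exp (-s ^ 2 + -2 * z.im * s) := by
  rw [Complex.norm_exp]
  congr 1
  simp [pow_two]

lemma integral_Ioi_mul_exp_neg_sq :
    ∫ s in Ioi (0 : ℝ), s * Real.exp (-s ^ 2) = 1 / 2 := by
  have h := integral_mul_cexp_neg_mul_sq (b := 1) (by simp)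
  have : ∫ s in Ioi (0 : ℝ), (s : ℂ) * Complex.exp (-1 * (s : ℂ) ^ 2)
      = ((∫ s in Ioi (0 : ℝ), s * Real.exp (-s ^ 2) : ℝ) : ℂ) := by
    rw [← integral_complex_ofReal]
    congr 1
    ext s
    push_cast
    ring_nf
  rw [this] at h
  have h2 : (((2 * 1)⁻¹ : ℂ)) = ((1 / 2 : ℝ) : ℂ) := by push_cast; norm_num
  rw [h2] at h
  exact_mod_cast h

lemma integral_Ioi_exp_neg_sq :
    ∫ s in Ioi (0 : ℝ), Real.exp (-s ^ 2) = √Real.pi / 2 := by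
  simpa using integral_gaussian_Ioi 1

/-! ### Integral representation and differential equation of the Faddeeva function -/

lemma faddeeva_eq_integral (z : ℂ) :
    faddeeva z = 2 / (√Real.pi : ℂ) *
      ∫ s in Ioi (0 : ℝ), Complex.exp (-(s : ℂ) ^ 2 + 2 * Complex.I * z * s) := by
  unfold faddeeva cerfc
  rw [mul_left_comm, ← integral_const_mul]
  congr 2
  ext s
  rw [← Complex.exp_add]
  congr 1
  linear_combination (-z ^ 2) * Complex.I_sq

/-- The bound for the Faddeeva function on the half-plane `-R ≤ Im z`. -/
noncomputable def faddeevaBound (R : ℝ) : ℝ :=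
  2 / √Real.pi * ∫ s in Ioi (0 : ℝ), Real.exp (-s ^ 2 + 2 * R * s)

lemma norm_faddeeva_le {R : ℝ} {z : ℂ} (hz : -R ≤ z.im) : ‖faddeeva z‖ ≤ faddeevaBound R := by
  have hpi : (0 : ℝ) < √Real.pi := Real.sqrt_pos.2 Real.pi_pos
  rw [faddeeva_eq_integral, norm_mul, faddeevaBound]
  have : ‖(2 / (√Real.pi : ℂ))‖ = 2 / √Real.pi := by
    simp [abs_of_pos hpi]
  rw [this]
  gcongr
  refine (norm_integral_le_integral_norm _).trans ?_
  refine setIntegral_mono_on (integrable_cexp_neg_sq_add _).norm.integrableOn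
    (integrable_exp_neg_sq_add _).integrableOn measurableSet_Ioi fun s hs => ?_
  rw [norm_cexp_neg_sq_add]
  have : (0 : ℝ) < s := hs
  apply Real.exp_le_exp.2
  nlinarith

lemma faddeevaBound_zero : faddeevaBound 0 = 1 := by
  have hpi : (0 : ℝ) < √Real.pi := Real.sqrt_pos.2 Real.pi_pos
  simp only [faddeevaBound, mul_zero, zero_mul, add_zero, integral_Ioi_exp_neg_sq]
  field_simp

lemma norm_faddeeva_le_one {z : ℂ} (hz : 0 ≤ z.im) : ‖faddeeva z‖ ≤ 1 := by
  rw [← faddeevaBound_zero]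
  exact norm_faddeeva_le (by simpa using hz)

lemma integrable_mul_cexp_neg_sq_add (c : ℂ) :
    IntegrableOn (fun s : ℝ => (s : ℂ) * Complex.exp (-(s : ℂ) ^ 2 + c * s)) (Ioi 0) := by
  refine Integrable.mono' (integrable_exp_neg_sq_add (c.re + 1)).integrableOn
    (by fun_prop) ?_
  filter_upwards [ae_restrict_mem measurableSet_Ioi] with s hs
  have hs : (0 : ℝ) < s := hs
  rw [norm_mul, Complex.norm_exp, Complex.norm_real, Real.norm_of_nonneg hs.le]
  calc s * Real.exp (-(s : ℂ) ^ 2 + c * s).re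
      ≤ Real.exp s * Real.exp (-(s : ℂ) ^ 2 + c * s).re := by
        gcongr; linarith [Real.add_one_le_exp s]
    _ = _ := by
        rw [← Real.exp_add]
        congr 1
        simp [pow_two]
        ring

/-- Integration of the derivative of `e^{-s² + cs}`, whose boundary value at `0` is `1`. This
converts differentiation under the integral sign into the differential equation for `w`. -/
lemma integral_mul_cexp_neg_sq_add (c : ℂ) :
    ∫ s in Ioi (0 : ℝ), (s : ℂ) * Complex.exp (-(s : ℂ) ^ 2 + c * s) =
      1 / 2 + c / 2 * ∫ s in Ioi (0 : ℝ), Complex.exp (-(s : ℂ) ^ 2 + c * s) := by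
  have hd : ∀ s : ℝ, HasDerivAt (fun s : ℝ => Complex.exp (-(s : ℂ) ^ 2 + c * s))
      (c * Complex.exp (-(s : ℂ) ^ 2 + c * s)
        - 2 * ((s : ℂ) * Complex.exp (-(s : ℂ) ^ 2 + c * s))) s := by
    intro s
    have h1 : HasDerivAt (fun x : ℂ => Complex.exp (-x ^ 2 + c * x))
        (Complex.exp (-(s : ℂ) ^ 2 + c * s) * (-(2 * (s : ℂ)) + c)) (s : ℂ) := by
      refine HasDerivAt.cexp ?_
      refine ((hasDerivAt_pow 2 (s : ℂ)).neg.add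
        ((hasDerivAt_id (s : ℂ)).const_mul c)).congr_deriv ?_
      simp
    refine h1.comp_ofReal.congr_deriv ?_
    ring
  have hi1 := (integrable_cexp_neg_sq_add c).integrableOn (s := Ioi (0 : ℝ))
  have hi2 := integrable_mul_cexp_neg_sq_add c
  have hlim : Tendsto (fun s : ℝ => Complex.exp (-(s : ℂ) ^ 2 + c * s)) atTop (𝓝 0) := by
    rw [tendsto_zero_iff_norm_tendsto_zero]
    have : ∀ s : ℝ, ‖Complex.exp (-(s : ℂ) ^ 2 + c * s)‖ = Real.exp (-(s * (s - c.re))) := by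
      intro s
      rw [Complex.norm_exp]
      congr 1
      simp [pow_two]
      ring
    simp only [this]
    exact Real.tendsto_exp_neg_atTop_nhds_zero.comp
      (tendsto_id.atTop_mul_atTop₀ (tendsto_atTop_add_const_right _ _ tendsto_id))
  have key := integral_Ioi_of_hasDerivAt_of_tendsto (a := 0)
    (hd 0).continuousAt.continuousWithinAt (fun s _ => hd s)
    ((hi1.const_mul c).sub (hi2.const_mul 2)) hlim
  rw [integral_sub (hi1.const_mul c) (hi2.const_mul 2), integral_const_mul,
    integral_const_mul] at key
  simp only [Complex.ofReal_zero] at key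
  simp at key
  linear_combination (-1 / 2 : ℂ) * key

lemma hasDerivAt_faddeeva_integral (z : ℂ) :
    HasDerivAt faddeeva (4 * Complex.I / (√Real.pi : ℂ) *
      ∫ s in Ioi (0 : ℝ), (s : ℂ) * Complex.exp (-(s : ℂ) ^ 2 + 2 * Complex.I * z * s)) z := by
  have hfun : faddeeva = fun z => 2 / (√Real.pi : ℂ) *
      ∫ s in Ioi (0 : ℝ), Complex.exp (-(s : ℂ) ^ 2 + 2 * Complex.I * z * s) :=
    funext faddeeva_eq_integral
  have key := (hasDerivAt_integral_of_dominated_loc_of_deriv_le (μ := volume.restrict (Ioi (0 : ℝ)))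
    (F := fun z (s : ℝ) => Complex.exp (-(s : ℂ) ^ 2 + 2 * Complex.I * z * s))
    (F' := fun z (s : ℝ) =>
      2 * Complex.I * ((s : ℂ) * Complex.exp (-(s : ℂ) ^ 2 + 2 * Complex.I * z * s)))
    (bound := fun s => 2 * Real.exp (-s ^ 2 + (2 * (‖z‖ + 1) + 1) * s))
    (x₀ := z) (Metric.ball_mem_nhds z one_pos)
    (Eventually.of_forall fun x => by fun_prop)
    (integrable_cexp_neg_sq_add _).integrableOn (by fun_prop) ?_
    ((integrable_exp_neg_sq_add _).integrableOn.const_mul 2) ?_).2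
  · rw [hfun]
    refine (key.const_mul (2 / (√Real.pi : ℂ))).congr_deriv ?_
    rw [integral_const_mul]
    ring
  · filter_upwards [ae_restrict_mem measurableSet_Ioi] with s hs x hx
    have hs : (0 : ℝ) < s := hs
    have h2 : ‖(2 * Complex.I : ℂ)‖ = 2 := by simp
    rw [norm_mul, h2, norm_mul, norm_cexp_neg_sq_add, Complex.norm_real, Real.norm_of_nonneg hs.le]
    gcongr
    have hx1 : -x.im ≤ ‖z‖ + 1 := by
      have h1 := Complex.abs_im_le_norm x
      have h3 : ‖x - z‖ < 1 := by simpa [dist_eq_norm] using hx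
      have h4 := norm_le_norm_add_norm_sub' x z
      linarith [neg_abs_le x.im]
    calc s * Real.exp (-s ^ 2 + -2 * x.im * s)
        ≤ Real.exp s * Real.exp (-s ^ 2 + -2 * x.im * s) := by
          gcongr; linarith [Real.add_one_le_exp s]
      _ ≤ _ := by
          rw [← Real.exp_add]
          apply Real.exp_le_exp.2
          nlinarith
  · refine ae_of_all _ fun s x _ => ?_
    have h1 : HasDerivAt (fun x : ℂ => Complex.exp (-(s : ℂ) ^ 2 + 2 * Complex.I * x * s))
        (Complex.exp (-(s : ℂ) ^ 2 + 2 * Complex.I * x * s) * (2 * Complex.I * s)) x := by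
      refine HasDerivAt.cexp ?_
      refine ((((hasDerivAt_id x).const_mul (2 * Complex.I)).mul_const (s : ℂ)).const_add
        (-(s : ℂ) ^ 2)).congr_deriv ?_
      simp
    refine h1.congr_deriv ?_
    ring

lemma hasDerivAt_faddeeva (z : ℂ) :
    HasDerivAt faddeeva (-2 * z * faddeeva z + 2 * Complex.I / (√Real.pi : ℂ)) z := by
  refine (hasDerivAt_faddeeva_integral z).congr_deriv ?_
  rw [integral_mul_cexp_neg_sq_add, faddeeva_eq_integral]
  linear_combination ((4 * z / (√Real.pi : ℂ)) *
    ∫ s in Ioi (0 : ℝ), Complex.exp (-(s : ℂ) ^ 2 + 2 * Complex.I * z * s)) * Complex.I_sq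

lemma differentiable_faddeeva : Differentiable ℂ faddeeva :=
  fun z => (hasDerivAt_faddeeva z).differentiableAt

/-- Equating the two expressions for `w'` gives `2zw = 2i/√π - (4i/√π) ∫ s e^{-s² + 2izs} ds`, and
for `Im z ≥ 0` the last integral is at most `∫ s e^{-s²} ds = 1/2` in modulus. -/
lemma norm_mul_norm_faddeeva_le {z : ℂ} (hz : 0 ≤ z.im) :
    ‖z‖ * ‖faddeeva z‖ ≤ 2 / √Real.pi := by
  have hpi : (0 : ℝ) < √Real.pi := Real.sqrt_pos.2 Real.pi_pos
  have heq := (hasDerivAt_faddeeva z).unique (hasDerivAt_faddeeva_integral z)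
  have hint : ‖∫ s in Ioi (0 : ℝ), (s : ℂ) * Complex.exp (-(s : ℂ) ^ 2 + 2 * Complex.I * z * s)‖
      ≤ 1 / 2 := by
    rw [← integral_Ioi_mul_exp_neg_sq]
    have hi : IntegrableOn (fun s : ℝ => s * Real.exp (-s ^ 2)) (Ioi 0) := by
      simpa using integrable_mul_exp_neg_mul_sq (b := 1) one_pos |>.integrableOn
    refine norm_integral_le_of_norm_le hi ?_
    filter_upwards [ae_restrict_mem measurableSet_Ioi] with s hs
    have hs : (0 : ℝ) < s := hs
    rw [norm_mul, norm_cexp_neg_sq_add, Complex.norm_real, Real.norm_of_nonneg hs.le]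
    gcongr
    nlinarith [mul_nonneg hz hs.le]
  have h2 : 2 * z * faddeeva z = 2 * Complex.I / (√Real.pi : ℂ) - 4 * Complex.I / (√Real.pi : ℂ) *
      ∫ s in Ioi (0 : ℝ), (s : ℂ) * Complex.exp (-(s : ℂ) ^ 2 + 2 * Complex.I * z * s) := by
    linear_combination -heq
  have h3 : 2 * (‖z‖ * ‖faddeeva z‖) = ‖2 * z * faddeeva z‖ := by
    rw [norm_mul, norm_mul]; simp; ring
  have h4 := norm_sub_le (2 * Complex.I / (√Real.pi : ℂ)) (4 * Complex.I / (√Real.pi : ℂ) *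
      ∫ s in Ioi (0 : ℝ), (s : ℂ) * Complex.exp (-(s : ℂ) ^ 2 + 2 * Complex.I * z * s))
  rw [← h2, ← h3, norm_mul] at h4
  have h5 : ‖(2 * Complex.I / (√Real.pi : ℂ))‖ = 2 / √Real.pi := by simp [abs_of_pos hpi]
  have h6 : ‖(4 * Complex.I / (√Real.pi : ℂ))‖ = 4 / √Real.pi := by simp [abs_of_pos hpi]
  rw [h5, h6] at h4
  have h7 := mul_le_mul_of_nonneg_left hint (by positivity : 0 ≤ 4 / √Real.pi)
  have h8 : 4 / √Real.pi * (1 / 2) = 2 / √Real.pi := by ring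
  linarith

/-- Under `s ↦ -s` the integral for `w(-z)` becomes the one for `w(z)` over the negative half-line,
so the two add up to a full Gaussian integral. -/
lemma faddeeva_add_faddeeva_neg (z : ℂ) :
    faddeeva z + faddeeva (-z) = 2 * Complex.exp (-z ^ 2) := by
  have hpi : (√Real.pi : ℂ) ≠ 0 := by
    exact_mod_cast (Real.sqrt_pos.2 Real.pi_pos).ne'
  have hi := integrable_cexp_neg_sq_add (2 * Complex.I * z)
  have h1 : ∫ s in Ioi (0 : ℝ), Complex.exp (-(s : ℂ) ^ 2 + 2 * Complex.I * (-z) * s)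
      = ∫ s in Iic (0 : ℝ), Complex.exp (-(s : ℂ) ^ 2 + 2 * Complex.I * z * s) := by
    have := integral_comp_neg_Ioi 0
      (fun s : ℝ => Complex.exp (-(s : ℂ) ^ 2 + 2 * Complex.I * z * s))
    rw [neg_zero] at this
    rw [← this]
    congr 1
    ext s
    push_cast
    ring_nf
  have h2 : (∫ s in Iic (0 : ℝ), Complex.exp (-(s : ℂ) ^ 2 + 2 * Complex.I * z * s))
      + ∫ s in Ioi (0 : ℝ), Complex.exp (-(s : ℂ) ^ 2 + 2 * Complex.I * z * s)
      = ∫ s : ℝ, Complex.exp (-(s : ℂ) ^ 2 + 2 * Complex.I * z * s) :=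
    intervalIntegral.integral_Iic_add_Ioi hi.integrableOn hi.integrableOn
  have h3 : ∫ s : ℝ, Complex.exp (-(s : ℂ) ^ 2 + 2 * Complex.I * z * s)
      = (√Real.pi : ℂ) * Complex.exp (-z ^ 2) := by
    have := integral_cexp_quadratic (b := -1) (by simp) (2 * Complex.I * z) 0
    simp only [neg_mul, one_mul, add_zero] at this
    rw [this]
    congr 1
    · rw [neg_neg, div_one, Real.sqrt_eq_rpow, Complex.ofReal_cpow Real.pi_pos.le]
      norm_num
    · congr 1
      linear_combination (z ^ 2) * Complex.I_sq
  rw [faddeeva_eq_integral, faddeeva_eq_integral, h1]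
  have h4 : ∀ A B : ℂ, 2 / (√Real.pi : ℂ) * A + 2 / (√Real.pi : ℂ) * B
      = 2 / (√Real.pi : ℂ) * (B + A) := fun A B => by ring
  rw [h4, h2, h3]
  field_simp

/-! ### A lower bound for the Faddeeva function in the sector `0 ≤ Im z ≤ Re z` -/

lemma sqrt_pi_gt : 1.77 < √Real.pi := by
  apply Real.lt_sqrt_of_sq_lt
  have := Real.pi_gt_d4
  norm_num at this ⊢
  linarith

lemma sqrt_pi_lt : √Real.pi < 1.773 := by
  rw [Real.sqrt_lt' (by norm_num)]
  have := Real.pi_lt_d4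
  norm_num at this ⊢
  linarith

lemma faddeeva_zero : faddeeva 0 = 1 := by
  have := faddeeva_add_faddeeva_neg 0
  simp at this
  linear_combination this / 2

/-- The real part of `(1 + i) / (z + 3 (1 + i) / 5)` on either half-axis, as a function of `|z|`. -/
noncomputable def axisMinorant (t : ℝ) : ℝ := (t + 6 / 5) / (t ^ 2 + 6 / 5 * t + 18 / 25)

lemma axisMinorant_denom_pos (t : ℝ) : 0 < t ^ 2 + 6 / 5 * t + 18 / 25 := by
  nlinarith [sq_nonneg (t + 3 / 5)]

lemma hasDerivAt_axisMinorant (t : ℝ) :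
    HasDerivAt axisMinorant
      (((t ^ 2 + 6 / 5 * t + 18 / 25) - (t + 6 / 5) * (2 * t + 6 / 5)) /
        (t ^ 2 + 6 / 5 * t + 18 / 25) ^ 2) t := by
  have h1 : HasDerivAt (fun t : ℝ => t + 6 / 5) 1 t := (hasDerivAt_id t).add_const _
  have h2 : HasDerivAt (fun t : ℝ => t ^ 2 + 6 / 5 * t + 18 / 25) (2 * t + 6 / 5) t := by
    refine (((hasDerivAt_pow 2 t).add ((hasDerivAt_id t).const_mul (6 / 5))).add_const
      (18 / 25)).congr_deriv ?_
    simp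
  refine (h1.div h2 (axisMinorant_denom_pos t).ne').congr_deriv ?_
  ring

lemma axisMinorant_deriv_real {t : ℝ} (ht : 0 ≤ t) :
    0 ≤ 2 - 2 * t * axisMinorant t -
      ((t ^ 2 + 6 / 5 * t + 18 / 25) - (t + 6 / 5) * (2 * t + 6 / 5)) /
        (t ^ 2 + 6 / 5 * t + 18 / 25) ^ 2 := by
  have hD := axisMinorant_denom_pos t
  have : 2 - 2 * t * axisMinorant t -
      ((t ^ 2 + 6 / 5 * t + 18 / 25) - (t + 6 / 5) * (2 * t + 6 / 5)) /
        (t ^ 2 + 6 / 5 * t + 18 / 25) ^ 2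
      = (t ^ 2 + 12 / 5 * t + 18 / 25 + 36 / 25 * (t ^ 2 + 6 / 5 * t + 18 / 25)) /
        (t ^ 2 + 6 / 5 * t + 18 / 25) ^ 2 := by
    rw [axisMinorant]
    field_simp
    ring
  rw [this]
  positivity

lemma axisMinorant_deriv_imag (t : ℝ) :
    2 * t * axisMinorant t - 2 -
      ((t ^ 2 + 6 / 5 * t + 18 / 25) - (t + 6 / 5) * (2 * t + 6 / 5)) /
        (t ^ 2 + 6 / 5 * t + 18 / 25) ^ 2 ≤ 0 := by
  have hD := axisMinorant_denom_pos t
  have : 2 * t * axisMinorant t - 2 -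
      ((t ^ 2 + 6 / 5 * t + 18 / 25) - (t + 6 / 5) * (2 * t + 6 / 5)) /
        (t ^ 2 + 6 / 5 * t + 18 / 25) ^ 2
      = -(11 / 25 * t ^ 2 - 84 / 125 * t + 198 / 625) /
        (t ^ 2 + 6 / 5 * t + 18 / 25) ^ 2 := by
    rw [axisMinorant]
    generalize h : t ^ 2 + 6 / 5 * t + 18 / 25 = D at hD ⊢
    field_simp
    rw [← h]
    ring
  rw [this]
  apply div_nonpos_of_nonpos_of_nonneg _ (by positivity)
  -- The quadratic has negative discriminant; `42/55` is its minimiser.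
  nlinarith [sq_nonneg (t - 42 / 55)]

lemma axisMinorant_le {t : ℝ} (ht : 0 ≤ t) : axisMinorant t ≤ 5 / 3 := by
  rw [axisMinorant, div_le_iff₀ (axisMinorant_denom_pos t)]
  nlinarith

/-- On the real axis `m = Re(√π (1 - i) w)` solves `m' = -2xm + 2`. With integrating factor `e^{x²}`
the difference from the minorant increases, starting from `√π - 5/3 > 0`. -/
lemma axisMinorant_le_real {x : ℝ} (hx : 0 ≤ x) :
    axisMinorant x ≤ (√Real.pi * (1 - Complex.I) * faddeeva x).re := by
  have hpi : (√Real.pi : ℂ) ≠ 0 := by exact_mod_cast (Real.sqrt_pos.2 Real.pi_pos).ne'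
  set m : ℝ → ℝ := fun x => (√Real.pi * (1 - Complex.I) * faddeeva x).re with hm
  have hmd : ∀ x : ℝ, HasDerivAt m (-2 * x * m x + 2) x := by
    intro x
    have h1 := ((hasDerivAt_faddeeva x).comp_ofReal.const_mul (√Real.pi * (1 - Complex.I)))
    have h2 := Complex.reCLM.hasFDerivAt.comp_hasDerivAt x h1
    refine HasDerivAt.congr_deriv h2 ?_
    have : (√Real.pi * (1 - Complex.I)) *
        (-2 * (x : ℂ) * faddeeva x + 2 * Complex.I / (√Real.pi : ℂ))
        = ((-2 * x : ℝ) : ℂ) * (√Real.pi * (1 - Complex.I) * faddeeva x)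
          + 2 * (1 + Complex.I) := by
      field_simp
      push_cast
      linear_combination (-2 : ℂ) * Complex.I_sq
    rw [this, Complex.reCLM_apply, Complex.add_re, Complex.re_ofReal_mul]
    simp [hm]
  have hF : ∀ x : ℝ, HasDerivAt (fun x => Real.exp (x ^ 2) * (m x - axisMinorant x))
      (Real.exp (x ^ 2) * (2 - 2 * x * axisMinorant x -
        ((x ^ 2 + 6 / 5 * x + 18 / 25) - (x + 6 / 5) * (2 * x + 6 / 5)) /
        (x ^ 2 + 6 / 5 * x + 18 / 25) ^ 2)) x := by
    intro x
    refine ((hasDerivAt_pow 2 x).exp.mul ((hmd x).sub (hasDerivAt_axisMinorant x))).congr_deriv ?_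
    simp
    ring
  have hmono : MonotoneOn (fun x => Real.exp (x ^ 2) * (m x - axisMinorant x)) (Ici 0) := by
    refine monotoneOn_of_deriv_nonneg (convex_Ici 0)
      (fun x _ => (hF x).continuousAt.continuousWithinAt)
      (fun x _ => (hF x).differentiableAt.differentiableWithinAt) fun x hx => ?_
    rw [(hF x).deriv]
    rw [interior_Ici] at hx
    exact mul_nonneg (Real.exp_pos _).le (axisMinorant_deriv_real (le_of_lt hx))
  have h0 := hmono (mem_Ici.2 le_rfl) (mem_Ici.2 hx) hx
  have hm0 : m 0 = √Real.pi := by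
    simp [hm, faddeeva_zero]
  have hq0 : axisMinorant 0 = 5 / 3 := by norm_num [axisMinorant]
  simp only [hm0, hq0] at h0
  have h1 : 0 ≤ Real.exp (x ^ 2) * (m x - axisMinorant x) := by
    refine le_trans ?_ h0
    have := sqrt_pi_gt
    norm_num at this ⊢
    linarith
  have := nonneg_of_mul_nonneg_right h1 (Real.exp_pos _)
  linarith

lemma abs_re_mul_faddeeva_le {z : ℂ} (hz : 0 ≤ z.im) :
    |(√Real.pi * (1 - Complex.I) * faddeeva z).re| ≤ 2 * √Real.pi := by
  refine (Complex.abs_re_le_norm _).trans ?_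
  rw [norm_mul, norm_mul]
  have h1 : ‖(√Real.pi : ℂ)‖ = √Real.pi := by simp
  have h2 : ‖(1 - Complex.I : ℂ)‖ ≤ 2 := (norm_sub_le _ _).trans (by simp; norm_num)
  rw [h1]
  calc √Real.pi * ‖(1 - Complex.I : ℂ)‖ * ‖faddeeva z‖ ≤ √Real.pi * 2 * 1 := by
        gcongr; exact norm_faddeeva_le_one hz
    _ = _ := by ring

/-- On the imaginary axis the equation is `m' = 2ym - 2`, unstable in the forward direction, so the
comparison starts at infinity: `e^{-y²} (m - axisMinorant)` decreases, and boundedness of both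
functions for `y ≥ 0` bounds it below by a quantity tending to `0`. -/
lemma axisMinorant_le_imag (y : ℝ) :
    axisMinorant y ≤ (√Real.pi * (1 - Complex.I) * faddeeva (y * Complex.I)).re := by
  have hpi : (√Real.pi : ℂ) ≠ 0 := by exact_mod_cast (Real.sqrt_pos.2 Real.pi_pos).ne'
  set m : ℝ → ℝ := fun y => (√Real.pi * (1 - Complex.I) * faddeeva (y * Complex.I)).re with hm
  have hmd : ∀ y : ℝ, HasDerivAt m (2 * y * m y - 2) y := by
    intro y
    have h0 : HasDerivAt (fun z : ℂ => z * Complex.I) Complex.I (y : ℂ) := by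
      simpa using (hasDerivAt_id (y : ℂ)).mul_const Complex.I
    have h1 := (((hasDerivAt_faddeeva (y * Complex.I)).comp (y : ℂ) h0).comp_ofReal.const_mul
      (√Real.pi * (1 - Complex.I)))
    have h2 := Complex.reCLM.hasFDerivAt.comp_hasDerivAt y h1
    refine HasDerivAt.congr_deriv h2 ?_
    have : (√Real.pi * (1 - Complex.I)) *
        ((-2 * ((y : ℂ) * Complex.I) * faddeeva (y * Complex.I)
          + 2 * Complex.I / (√Real.pi : ℂ)) * Complex.I)
        = ((2 * y : ℝ) : ℂ) * (√Real.pi * (1 - Complex.I) * faddeeva (y * Complex.I))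
          + 2 * (Complex.I - 1) := by
      generalize faddeeva (y * Complex.I) = W
      field_simp
      push_cast
      have := Complex.I_sq
      linear_combination (2 * (1 - Complex.I) * (1 - y * (√Real.pi : ℂ) * W)) * this
    rw [this, Complex.reCLM_apply, Complex.add_re, Complex.re_ofReal_mul]
    simp [hm]
    ring
  have hF : ∀ y : ℝ, HasDerivAt (fun y => Real.exp (-y ^ 2) * (m y - axisMinorant y))
      (Real.exp (-y ^ 2) * (2 * y * axisMinorant y - 2 -
        ((y ^ 2 + 6 / 5 * y + 18 / 25) - (y + 6 / 5) * (2 * y + 6 / 5)) /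
        (y ^ 2 + 6 / 5 * y + 18 / 25) ^ 2)) y := by
    intro y
    refine ((hasDerivAt_pow 2 y).neg.exp.mul
      ((hmd y).sub (hasDerivAt_axisMinorant y))).congr_deriv ?_
    simp
    ring
  have hanti : Antitone (fun y => Real.exp (-y ^ 2) * (m y - axisMinorant y)) := by
    refine antitone_of_deriv_nonpos (fun x => (hF x).differentiableAt) fun x => ?_
    rw [(hF x).deriv]
    exact mul_nonpos_of_nonneg_of_nonpos (Real.exp_pos _).le (axisMinorant_deriv_imag x)
  have hlim : Tendsto (fun y : ℝ => Real.exp (-y ^ 2) * (-2 * √Real.pi - 5 / 3)) atTop (𝓝 0) := by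
    have h1 : Tendsto (fun y : ℝ => Real.exp (-y ^ 2)) atTop (𝓝 0) :=
      Real.tendsto_exp_neg_atTop_nhds_zero.comp (tendsto_pow_atTop two_ne_zero)
    simpa using h1.mul_const (-2 * √Real.pi - 5 / 3)
  have h1 : 0 ≤ Real.exp (-y ^ 2) * (m y - axisMinorant y) := by
    refine le_of_tendsto hlim ?_
    filter_upwards [eventually_ge_atTop y, eventually_ge_atTop 0] with t ht ht0
    refine le_trans ?_ (hanti ht)
    have h2 := axisMinorant_le ht0
    have h3 := abs_re_mul_faddeeva_le (z := t * Complex.I) (by simpa using ht0)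
    have h4 := neg_abs_le (m t)
    have h5 : |m t| ≤ 2 * √Real.pi := h3
    apply mul_le_mul_of_nonneg_left _ (Real.exp_pos _).le
    linarith
  have := nonneg_of_mul_nonneg_right h1 (Real.exp_pos _)
  linarith

lemma re_div_add_diagonal (z : ℂ) :
    ((1 + Complex.I) / (z + 3 / 5 * (1 + Complex.I))).re =
      (z.re + z.im + 6 / 5) / ((z.re + 3 / 5) ^ 2 + (z.im + 3 / 5) ^ 2) := by
  have hre : (z + 3 / 5 * (1 + Complex.I)).re = z.re + 3 / 5 := by simp
  have him : (z + 3 / 5 * (1 + Complex.I)).im = z.im + 3 / 5 := by simp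
  rw [Complex.div_re, Complex.normSq_apply, hre, him, ← add_div]
  simp
  ring

/-- The left side is `Re((1 + i)/(z + c(1 + i)))` with `c = 3/5`; its leading behaviour `(1 + i)/z`
at infinity is that of `√π (1 - i) w`. The choice of `c` has to satisfy `1/c ≤ √π` at the origin and
keep the derivative comparison on the imaginary axis valid. Exponentiating the difference makes the
inequality a modulus bound for a holomorphic function. -/
lemma le_re_mul_faddeeva {z : ℂ} (hx : 0 ≤ z.re) (hy : 0 ≤ z.im) :
    (z.re + z.im + 6 / 5) / ((z.re + 3 / 5) ^ 2 + (z.im + 3 / 5) ^ 2) ≤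
      (√Real.pi * (1 - Complex.I) * faddeeva z).re := by
  set f : ℂ → ℂ := fun z => Complex.exp ((1 + Complex.I) / (z + 3 / 5 * (1 + Complex.I))
    - √Real.pi * (1 - Complex.I) * faddeeva z) with hf
  have hnorm : ∀ z, ‖f z‖ = Real.exp
      ((z.re + z.im + 6 / 5) / ((z.re + 3 / 5) ^ 2 + (z.im + 3 / 5) ^ 2)
        - (√Real.pi * (1 - Complex.I) * faddeeva z).re) := by
    intro z
    rw [hf, Complex.norm_exp, Complex.sub_re, re_div_add_diagonal]
  have hcl : closure (Ioi (0 : ℝ) ×ℂ Ioi (0 : ℝ)) ⊆ {z : ℂ | 0 ≤ z.re ∧ 0 ≤ z.im} := by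
    rw [Complex.closure_reProdIm, closure_Ioi]
    exact fun z hz => hz
  have hne : ∀ z : ℂ, 0 ≤ z.re → z + 3 / 5 * (1 + Complex.I) ≠ 0 := by
    intro z hz h
    have := congrArg Complex.re h
    simp at this
    linarith
  have hdiff : ∀ z : ℂ, 0 ≤ z.re → DifferentiableAt ℂ f z := by
    intro z hz
    have := differentiable_faddeeva z
    have := hne z hz
    simp only [hf]
    fun_prop (disch := assumption)
  have key : ‖f z‖ ≤ 1 := by
    -- The function is bounded in the quadrant, so growth exponent `0 < 2` and coefficient `0`
    -- suffice.
    refine PhragmenLindelof.quadrant_I (DifferentiableOn.diffContOnCl fun z hz =>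
      (hdiff z (hcl hz).1).differentiableWithinAt) ⟨0, two_pos, 0, ?_⟩ ?_ ?_ hx hy
    · refine Asymptotics.IsBigO.of_bound (Real.exp (5 / 3 + 2 * √Real.pi)) ?_
      refine Eventually.filter_mono inf_le_right (eventually_principal.2 fun z hz => ?_)
      obtain ⟨h1, h2⟩ := hz
      have h1 : 0 < z.re := h1
      have h2 : 0 < z.im := h2
      rw [hnorm]
      simp only [zero_mul, Real.exp_zero, norm_one, mul_one]
      apply Real.exp_le_exp.2
      have h3 := neg_abs_le (√Real.pi * (1 - Complex.I) * faddeeva z).re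
      have h4 := abs_re_mul_faddeeva_le h2.le
      have h5 : (z.re + z.im + 6 / 5) / ((z.re + 3 / 5) ^ 2 + (z.im + 3 / 5) ^ 2) ≤ 5 / 3 := by
        rw [div_le_iff₀ (by positivity)]
        nlinarith
      linarith
    · intro x hx
      rw [hnorm]
      apply Real.exp_le_one_iff.2
      have := axisMinorant_le_real hx
      rw [axisMinorant] at this
      simp only [Complex.ofReal_re, Complex.ofReal_im]
      ring_nf at this ⊢
      linarith
    · intro y _
      rw [hnorm]
      apply Real.exp_le_one_iff.2
      have := axisMinorant_le_imag y
      rw [axisMinorant] at this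
      simp only [Complex.re_ofReal_mul, Complex.im_ofReal_mul, Complex.I_re, Complex.I_im]
      ring_nf at this ⊢
      linarith
  rw [hnorm, Real.exp_le_one_iff] at key
  linarith

/-- With `X = x + 3/5` and `Y = y + 3/5`, `Y ≤ X` gives `X² + Y² ≤ X(X + Y)`, so the minorant is at
least `1/X`; the factor `√2` is `|1 - i|`. -/
lemma one_le_mul_norm_faddeeva {z : ℂ} (hy : 0 ≤ z.im) (hyx : z.im ≤ z.re) :
    1 ≤ √2 * (√Real.pi * (z.re + 3 / 5)) * ‖faddeeva z‖ := by
  have h1 := le_re_mul_faddeeva (hy.trans hyx) hy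
  have h2 : 1 / (z.re + 3 / 5) ≤
      (z.re + z.im + 6 / 5) / ((z.re + 3 / 5) ^ 2 + (z.im + 3 / 5) ^ 2) := by
    rw [div_le_div_iff₀ (by linarith) (by positivity)]
    nlinarith
  have h3 := Complex.re_le_norm (√Real.pi * (1 - Complex.I) * faddeeva z)
  have h4 : ‖(1 - Complex.I : ℂ)‖ = √2 := by
    rw [Complex.norm_def, Complex.normSq_apply]
    norm_num
  have h5 : ‖(√Real.pi : ℂ)‖ = √Real.pi := by simp
  rw [norm_mul, norm_mul, h4, h5] at h3
  have h6 := (h2.trans h1).trans h3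
  rw [div_le_iff₀ (by linarith)] at h6
  linarith

lemma faddeeva_ne_zero {z : ℂ} (hy : 0 ≤ z.im) (hyx : z.im ≤ z.re) : faddeeva z ≠ 0 := by
  intro h
  have := one_le_mul_norm_faddeeva hy hyx
  rw [h, norm_zero, mul_zero] at this
  linarith

/-! ### The continued modified trapezoidal rule and its error -/

/-- The `n`-th Fourier mode of the error of the modified trapezoidal rule. -/
noncomputable def modTrapErrorTerm (h α : ℝ) (n : ℕ) (z : ℂ) : ℂ :=
  ((Real.cos (2 * Real.pi * (n + 1) * α) * Real.exp (-(Real.pi * (n + 1) / h) ^ 2) : ℝ) : ℂ) *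
    (faddeeva (z + ((Real.pi * (n + 1) / h : ℝ) : ℂ) * Complex.I) -
      faddeeva (((Real.pi * (n + 1) / h : ℝ) : ℂ) * Complex.I - z))

/-- The entire function `z ↦ I*_{h,α}[f_z]`. -/
noncomputable def modTrapFaddeeva (h α : ℝ) (z : ℂ) : ℂ :=
  faddeeva z + ∑' n, modTrapErrorTerm h α n z

section Bounds

variable {h : ℝ}

lemma half_lt_sq (h_pos : 0 < h) (h_lt : h < √2 * Real.pi) : 1 / 2 < (Real.pi / h) ^ 2 := by
  have h2 : h ^ 2 < 2 * Real.pi ^ 2 := by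
    calc h ^ 2 < (√2 * Real.pi) ^ 2 := by gcongr
      _ = _ := by rw [mul_pow, Real.sq_sqrt two_pos.le]
  rw [div_pow, div_lt_div_iff₀ two_pos (by positivity)]
  linarith

/-- With `a = π/h` the exponent is `√2 a (1 - √2 a)`, negative exactly when `h < √2 π`. -/
lemma trapErr_ratio_lt_one (h_pos : 0 < h) (h_lt : h < √2 * Real.pi) :
    Real.exp (-2 * Real.pi ^ 2 / h ^ 2 + √2 * Real.pi / h) < 1 := by
  rw [Real.exp_lt_one_iff]
  have ha : 0 < Real.pi / h := by positivity
  have h1 : 1 < √2 * (Real.pi / h) := by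
    rw [← mul_div_assoc, one_lt_div h_pos]
    exact h_lt
  have h2 : √2 * √2 = 2 := Real.mul_self_sqrt two_pos.le
  have h3 : -2 * Real.pi ^ 2 / h ^ 2 + √2 * Real.pi / h
      = √2 * (Real.pi / h) * (1 - √2 * (Real.pi / h)) := by
    field_simp
    linear_combination (Real.pi) * h2
  rw [h3]
  exact mul_neg_of_pos_of_neg (by positivity) (by linarith)

/-- From `(n + 1)² ≥ 1 + 2n`. The positive term `√2 π/h` in the ratio is pure slack here. -/
lemma exp_neg_sq_le_geometric (h_pos : 0 < h) (n : ℕ) :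
    Real.exp (-(Real.pi * (n + 1) / h) ^ 2) ≤ Real.exp (-Real.pi ^ 2 / h ^ 2) *
      Real.exp (-2 * Real.pi ^ 2 / h ^ 2 + √2 * Real.pi / h) ^ n := by
  rw [← Real.exp_nat_mul, ← Real.exp_add, Real.exp_le_exp]
  have ha : 0 < Real.pi / h := by positivity
  have h1 : -(Real.pi * (n + 1) / h) ^ 2 = -((Real.pi / h) ^ 2 * (n + 1) ^ 2) := by
    field_simp
  have h2 : -Real.pi ^ 2 / h ^ 2 + n * (-2 * Real.pi ^ 2 / h ^ 2 + √2 * Real.pi / h)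
      = -(Real.pi / h) ^ 2 - 2 * n * (Real.pi / h) ^ 2 + n * √2 * (Real.pi / h) := by
    field_simp
    ring
  rw [h1, h2]
  have : 0 ≤ n * √2 * (Real.pi / h) := by positivity
  nlinarith [sq_nonneg ((n : ℝ) * (Real.pi / h))]

lemma summable_exp_neg_sq (h_pos : 0 < h) (h_lt : h < √2 * Real.pi) :
    Summable fun n : ℕ => Real.exp (-(Real.pi * (n + 1) / h) ^ 2) :=
  Summable.of_nonneg_of_le (fun _ => (Real.exp_pos _).le) (exp_neg_sq_le_geometric h_pos)
    ((summable_geometric_of_lt_one (Real.exp_pos _).le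
      (trapErr_ratio_lt_one h_pos h_lt)).mul_left _)

lemma tsum_exp_neg_sq_le (h_pos : 0 < h) (h_lt : h < √2 * Real.pi) :
    ∑' n : ℕ, Real.exp (-(Real.pi * (n + 1) / h) ^ 2) ≤ trapErrFactor h := by
  have hr := trapErr_ratio_lt_one h_pos h_lt
  have hs := (hasSum_geometric_of_lt_one (Real.exp_pos _).le hr).mul_left
    (Real.exp (-Real.pi ^ 2 / h ^ 2))
  rw [trapErrFactor, div_eq_mul_inv, ← hs.tsum_eq]
  exact (summable_exp_neg_sq h_pos h_lt).tsum_le_tsum (exp_neg_sq_le_geometric h_pos) hs.summable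

lemma norm_modTrapErrorTerm_le {α : ℝ} {n : ℕ} {z : ℂ} {C : ℝ}
    (hC : ‖faddeeva (z + ((Real.pi * (n + 1) / h : ℝ) : ℂ) * Complex.I) -
      faddeeva (((Real.pi * (n + 1) / h : ℝ) : ℂ) * Complex.I - z)‖ ≤ C) :
    ‖modTrapErrorTerm h α n z‖ ≤ Real.exp (-(Real.pi * (n + 1) / h) ^ 2) * C := by
  rw [modTrapErrorTerm, norm_mul, Complex.norm_real, norm_mul, Real.norm_eq_abs, Real.norm_eq_abs,
    Real.abs_exp]
  gcongr
  exact mul_le_of_le_one_left (Real.exp_pos _).le (Real.abs_cos_le_one _)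

/-- On the disc `|z| < R` both arguments of `w` stay in `Im ≥ -R` whatever `n` is; this is the
majorant for the Weierstrass test. -/
lemma norm_modTrapErrorTerm_le_of_norm_lt (h_pos : 0 < h) (α : ℝ) (n : ℕ) {z : ℂ} {R : ℝ}
    (hz : ‖z‖ < R) : ‖modTrapErrorTerm h α n z‖ ≤
      Real.exp (-(Real.pi * (n + 1) / h) ^ 2) * (2 * faddeevaBound R) := by
  have hb : 0 < Real.pi * (n + 1) / h := by positivity
  have him := abs_le.1 (Complex.abs_im_le_norm z)
  refine norm_modTrapErrorTerm_le ((norm_sub_le _ _).trans ?_)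
  rw [two_mul]
  refine add_le_add (norm_faddeeva_le ?_) (norm_faddeeva_le ?_)
  · rw [Complex.add_im, Complex.im_ofReal_mul, Complex.I_im]
    linarith
  · rw [Complex.sub_im, Complex.im_ofReal_mul, Complex.I_im]
    linarith

lemma differentiable_modTrapFaddeeva (h_pos : 0 < h) (h_lt : h < √2 * Real.pi) (α : ℝ) :
    Differentiable ℂ (modTrapFaddeeva h α) := by
  intro z
  have hd := Complex.differentiableOn_tsum_of_summable_norm (F := modTrapErrorTerm h α)
    (U := Metric.ball 0 (‖z‖ + 1))
    ((summable_exp_neg_sq h_pos h_lt).mul_right (2 * faddeevaBound (‖z‖ + 1)))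
    (fun n => by
      have := differentiable_faddeeva
      unfold modTrapErrorTerm
      exact Differentiable.differentiableOn (by fun_prop)) Metric.isOpen_ball
    (fun n w hw => norm_modTrapErrorTerm_le_of_norm_lt h_pos α n (by simpa using hw))
  exact (differentiable_faddeeva z).add
    (hd.differentiableAt (Metric.isOpen_ball.mem_nhds (by simp)))

/-! ### Bounds for a single error mode in the sector -/

lemma norm_faddeeva_mul_le {z : ℂ} (hz : 0 ≤ z.im) :
    ‖faddeeva z‖ * (√Real.pi * (|z.re| + 3 / 5)) ≤ 3.064 := by
  have hpi : (0 : ℝ) < √Real.pi := Real.sqrt_pos.2 Real.pi_pos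
  have h1 := norm_faddeeva_le_one hz
  have h2 := norm_mul_norm_faddeeva_le hz
  rw [le_div_iff₀ hpi] at h2
  have h3 : |z.re| * ‖faddeeva z‖ * √Real.pi ≤ ‖z‖ * ‖faddeeva z‖ * √Real.pi := by
    gcongr
    exact Complex.abs_re_le_norm z
  have h4 : ‖faddeeva z‖ * √Real.pi ≤ 1 * √Real.pi := by gcongr
  -- `3.064` rounds up `2 + 1.773 · 3/5`, from `|z w| √π ≤ 2` and `|w| ≤ 1`.
  have h5 := sqrt_pi_lt
  norm_num at h5 ⊢
  nlinarith

/-- Here `bx ≥ b² > 1/2` bounds the exponential by `e^{-1/2} < 0.607`, while `u e^{-u} ≤ e^{-1}` and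
`b > 0.7071` give `x e^{-bx} ≤ 0.5203`. -/
lemma exp_mul_le {b x : ℝ} (hb : 1 / 2 < b ^ 2) (hb0 : 0 < b) (hx : b ≤ x) :
    Real.exp (-(b * x)) * (√Real.pi * (x + 3 / 5)) ≤ 1.57 := by
  have hpi := sqrt_pi_lt
  have h7 : 0.7071 < b := by
    by_contra! hle
    norm_num at hle
    nlinarith
  have he : Real.exp (-1) < 0.3679 := by
    have := Real.exp_neg_one_lt_d9
    norm_num at this ⊢
    linarith
  have h1 : Real.exp (-(b * x)) ≤ 0.607 := by
    have h2 : Real.exp (-(b * x)) ^ 2 ≤ 0.607 ^ 2 := by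
      rw [← Real.exp_nat_mul]
      refine le_trans (Real.exp_le_exp.2 (?_ : _ ≤ (-1 : ℝ))) (he.le.trans (by norm_num))
      push_cast
      nlinarith
    exact le_of_sq_le_sq h2 (by norm_num)
  have h2 : b * x * Real.exp (-(b * x)) ≤ Real.exp (-1) := by
    have h3 := Real.add_one_le_exp (b * x - 1)
    calc b * x * Real.exp (-(b * x)) ≤ Real.exp (b * x - 1) * Real.exp (-(b * x)) := by
          gcongr; linarith
      _ = _ := by rw [← Real.exp_add]; congr 1; ring
  have h4 : x * Real.exp (-(b * x)) ≤ 0.5203 := by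
    have h5 : 0 ≤ x * Real.exp (-(b * x)) := mul_nonneg (by linarith) (Real.exp_pos _).le
    norm_num at h7 he ⊢
    nlinarith
  have hx0 : 0 ≤ x := by linarith
  have h6 : Real.exp (-(b * x)) * (x + 3 / 5) ≤ 0.5203 + 0.607 * (3 / 5) := by
    nlinarith
  calc Real.exp (-(b * x)) * (√Real.pi * (x + 3 / 5))
      = √Real.pi * (Real.exp (-(b * x)) * (x + 3 / 5)) := by ring
    _ ≤ 1.773 * (0.5203 + 0.607 * (3 / 5)) := by gcongr
    _ ≤ _ := by norm_num

lemma norm_faddeeva_sub_le {b : ℝ} {z : ℂ} (hb : 1 / 2 < b ^ 2) (hb0 : 0 < b) (hy : 0 ≤ z.im)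
    (hyx : z.im ≤ z.re) :
    ‖faddeeva (z + b * Complex.I) - faddeeva (b * Complex.I - z)‖ ≤ 4 ∧
    ‖faddeeva (z + b * Complex.I) - faddeeva (b * Complex.I - z)‖ *
      (√Real.pi * (z.re + 3 / 5)) ≤ 9.27 := by
  have hx : 0 ≤ z.re := hy.trans hyx
  have hs : 0 ≤ √Real.pi * (z.re + 3 / 5) := by positivity
  have hsub := norm_sub_le (faddeeva (z + b * Complex.I)) (faddeeva (b * Complex.I - z))
  have h1i : 0 ≤ (z + b * Complex.I).im := by simpa using add_nonneg hy hb0.le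
  have h1 := norm_faddeeva_le_one h1i
  have h1' := norm_faddeeva_mul_le h1i
  have hr1 : (z + b * Complex.I).re = z.re := by simp
  rw [hr1, abs_of_nonneg hx] at h1'
  -- The constants come from the worse case `y ≥ b`: `3 = 2 + 1` and `6.204 = 2 · 1.57 + 3.064`;
  -- adding `3.064` for the other term stays below `9.27`.
  suffices h : ‖faddeeva (b * Complex.I - z)‖ ≤ 3 ∧
      ‖faddeeva (b * Complex.I - z)‖ * (√Real.pi * (z.re + 3 / 5)) ≤ 6.204 by
    refine ⟨by linarith [h.1], ?_⟩
    have := mul_le_mul_of_nonneg_right hsub hs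
    rw [add_mul] at this
    have := h.2
    norm_num at *
    linarith
  rcases le_total z.im b with hyb | hyb
  · have h2i : 0 ≤ (b * Complex.I - z).im := by simpa using hyb
    have h2 := norm_faddeeva_le_one h2i
    have h2' := norm_faddeeva_mul_le h2i
    have hr2 : (b * Complex.I - z).re = -z.re := by simp
    rw [hr2, abs_neg, abs_of_nonneg hx] at h2'
    norm_num at *
    exact ⟨by linarith, by linarith⟩
  · have h2i : 0 ≤ (z - b * Complex.I).im := by simpa using hyb
    have h2 := norm_faddeeva_le_one h2i
    have h2' := norm_faddeeva_mul_le h2i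
    have hr2 : (z - b * Complex.I).re = z.re := by simp
    rw [hr2, abs_of_nonneg hx] at h2'
    -- Now `ib - z` lies in the closed lower half-plane, so it is reflected. The exponential has
    -- modulus `e^{-(x-y+b)(x+y-b)} ≤ e^{-bx}`, since `y ≤ x` and `b ≤ y`.
    have heq := faddeeva_add_faddeeva_neg (z - b * Complex.I)
    rw [neg_sub] at heq
    have hle : ‖faddeeva (b * Complex.I - z)‖ ≤
        2 * Real.exp (-(b * z.re)) + ‖faddeeva (z - b * Complex.I)‖ := by
      rw [eq_sub_of_add_eq' heq]
      refine (norm_sub_le _ _).trans ?_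
      gcongr
      rw [norm_mul, Complex.norm_exp]
      simp only [Complex.norm_ofNat]
      gcongr
      simp [pow_two]
      nlinarith
    have hexp : Real.exp (-(b * z.re)) ≤ 1 := Real.exp_le_one_iff.2 (by nlinarith)
    have hexp' := exp_mul_le hb hb0 (hyb.trans hyx)
    refine ⟨by linarith, ?_⟩
    have := mul_le_mul_of_nonneg_right hle hs
    rw [add_mul] at this
    norm_num at *
    linarith

lemma half_lt_mode_sq (h_pos : 0 < h) (h_lt : h < √2 * Real.pi) (n : ℕ) :
    1 / 2 < (Real.pi * (n + 1) / h) ^ 2 := by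
  refine (half_lt_sq h_pos h_lt).trans_le ?_
  gcongr
  exact le_mul_of_one_le_right Real.pi_pos.le (by simp)

lemma norm_modTrapFaddeeva_sub_le {C : ℝ} {z : ℂ} (h_pos : 0 < h) (h_lt : h < √2 * Real.pi)
    (α : ℝ) (hC0 : 0 ≤ C)
    (hC : ∀ b : ℝ, 1 / 2 < b ^ 2 → 0 < b →
      ‖faddeeva (z + b * Complex.I) - faddeeva (b * Complex.I - z)‖ ≤ C) :
    ‖faddeeva z - modTrapFaddeeva h α z‖ ≤ C * trapErrFactor h := by
  have hs := (summable_exp_neg_sq h_pos h_lt).mul_right C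
  rw [modTrapFaddeeva, sub_add_cancel_left, norm_neg]
  refine (tsum_of_norm_bounded hs.hasSum fun n => norm_modTrapErrorTerm_le
    (hC _ (half_lt_mode_sq h_pos h_lt n) (by positivity))).trans ?_
  rw [tsum_mul_right, mul_comm]
  gcongr
  exact tsum_exp_neg_sq_le h_pos h_lt

lemma trapErrFactor_nonneg (h_pos : 0 < h) (h_lt : h < √2 * Real.pi) : 0 ≤ trapErrFactor h :=
  (tsum_nonneg fun _ => (Real.exp_pos _).le).trans (tsum_exp_neg_sq_le h_pos h_lt)

/-! ### Numerical comparison with `cAbs` and `cRel` -/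

lemma four_le_cAbs : 4 ≤ cAbs := by
  have h1 : √(Real.exp 1 * Real.pi) ≤ 3 := by
    rw [Real.sqrt_le_left (by norm_num)]
    have h2 := Real.exp_one_lt_d9
    have h3 := Real.pi_lt_d4
    norm_num at *
    nlinarith [Real.pi_pos, Real.exp_pos 1]
  have h2 := Real.exp_one_gt_d9
  have h3 := sqrt_pi_gt
  have h4 : 0 < √(Real.exp 1 * Real.pi) := by positivity
  rw [cAbs, le_div_iff₀ h4]
  norm_num at *
  linarith

/-- Since `cRel / h` decreases in `h`, the inequality is checked at the endpoint `h = √2 π`. -/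
lemma mul_le_cRel_div (h_pos : 0 < h) (h_lt : h < √2 * Real.pi) : √2 * 9.27 ≤ cRel / h := by
  have h1 : √(Real.exp 1) ≤ 1.65 := by
    rw [Real.sqrt_le_left (by norm_num)]
    have h2 := Real.exp_one_lt_d9
    norm_num at *
    linarith
  have h2 := Real.exp_one_gt_d9
  have h3 := sqrt_pi_gt
  have h4 : 0 < √(Real.exp 1) := by positivity
  have h5 : √2 * √2 = 2 := Real.mul_self_sqrt two_pos.le
  have h6 : (1.414 : ℝ) ≤ √2 := by
    apply Real.le_sqrt_of_sq_le
    norm_num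
  have h7 : √Real.pi * √Real.pi = Real.pi := Real.mul_self_sqrt Real.pi_pos.le
  have h8 := sqrt_pi_lt
  rw [le_div_iff₀ h_pos, cRel, le_div_iff₀ h4, Real.sqrt_mul two_pos.le]
  calc √2 * 9.27 * h * √(Real.exp 1) ≤ √2 * 9.27 * (√2 * Real.pi) * 1.65 := by gcongr
    _ = (2 * 9.27 * 1.65) * √Real.pi * √Real.pi := by
        rw [mul_assoc _ √Real.pi, h7]
        linear_combination 9.27 * 1.65 * Real.pi * h5
    _ ≤ (2 * 9.27 * 1.65) * √Real.pi * 1.773 := by gcongr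
    _ ≤ 2 * (1.414 * √Real.pi) * (1 + 1.77) * (2 * 2.718 + 1.77) := by
        norm_num at *
        nlinarith
    _ ≤ _ := by
        gcongr
        norm_num at *
        linarith

end Bounds

/-! ### Poisson summation for the trapezoidal sums -/

section Poisson

variable {h : ℝ} {z : ℂ}

lemma summable_exp_neg_sq_shift (h_pos : 0 < h) (α : ℝ) :
    Summable fun k : ℤ => Real.exp (-(((k : ℝ) - α) * h) ^ 2) := by
  -- The parameters make the theta majorant equal to `e^{-h²k² + 2h²|α||k|}`.
  have hs := summable_pow_mul_jacobiTheta₂_term_bound (h ^ 2 * |α| / Real.pi)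
    (T := h ^ 2 / Real.pi) (by positivity) 0
  refine Summable.of_nonneg_of_le (fun _ => (Real.exp_pos _).le) (fun k => ?_) hs
  rw [pow_zero, one_mul, Real.exp_le_exp]
  have h1 : -Real.pi * (h ^ 2 / Real.pi * k ^ 2 - 2 * (h ^ 2 * |α| / Real.pi) * ((|k| : ℤ) : ℝ))
      = -(h ^ 2 * k ^ 2) + 2 * h ^ 2 * (|α| * |(k : ℝ)|) := by
    field_simp
    push_cast
    ring
  have h2 : α * k ≤ |α| * |(k : ℝ)| := by
    rw [← abs_mul]
    exact le_abs_self _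
  rw [h1]
  nlinarith [sq_nonneg (α * h), mul_le_mul_of_nonneg_left h2 (sq_nonneg h)]

/-- Poisson summation for a Gaussian (the Jacobi theta transformation) with parameter `h²/π`; the
shift `α` becomes a phase on the dual side. -/
lemma tsum_cexp_shift_eq (h_pos : 0 < h) (α s : ℝ) :
    h * ∑' k : ℤ, Complex.exp (-((((k : ℝ) - α) * h : ℝ) : ℂ) ^ 2 +
        2 * Complex.I * ((((k : ℝ) - α) * h : ℝ) : ℂ) * s) =
      √Real.pi * ∑' n : ℤ, Complex.exp (-2 * Real.pi * Complex.I * n * α) *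
        Complex.exp (-((s : ℂ) - (Real.pi / h : ℝ) * n) ^ 2) := by
  have hh : (h : ℂ) ≠ 0 := by exact_mod_cast h_pos.ne'
  have hpi : (Real.pi : ℂ) ≠ 0 := by exact_mod_cast Real.pi_ne_zero
  have key := Complex.tsum_exp_neg_quadratic (a := ((h ^ 2 / Real.pi : ℝ) : ℂ))
    (by rw [Complex.ofReal_re]; positivity) ((h ^ 2 * α + Complex.I * s * h) / Real.pi)
  have hroot : (((h ^ 2 / Real.pi : ℝ) : ℂ) ^ (1 / 2 : ℂ)) = ((h / √Real.pi : ℝ) : ℂ) := by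
    have : h / √Real.pi = (h ^ 2 / Real.pi) ^ (1 / 2 : ℝ) := by
      rw [← Real.sqrt_eq_rpow, Real.sqrt_div (by positivity), Real.sqrt_sq h_pos.le]
    rw [this, Complex.ofReal_cpow (by positivity)]
    norm_num
  rw [hroot] at key
  -- The part of the exponent independent of `k`; the same factor appears on the dual side after
  -- expanding its square.
  set pre := Complex.exp (-(h ^ 2 * α ^ 2) - 2 * Complex.I * s * h * α) with hpre
  have h1 : ∀ k : ℤ, Complex.exp (-((((k : ℝ) - α) * h : ℝ) : ℂ) ^ 2 +
        2 * Complex.I * ((((k : ℝ) - α) * h : ℝ) : ℂ) * s) = pre *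
      Complex.exp (-Real.pi * ((h ^ 2 / Real.pi : ℝ) : ℂ) * k ^ 2 +
        2 * Real.pi * ((h ^ 2 * α + Complex.I * s * h) / Real.pi) * k) := by
    intro k
    rw [hpre, ← Complex.exp_add]
    congr 1
    push_cast
    field_simp
    ring
  have h2 : ∀ n : ℤ, Complex.exp (-2 * Real.pi * Complex.I * n * α) *
        Complex.exp (-((s : ℂ) - (Real.pi / h : ℝ) * n) ^ 2) = pre *
      Complex.exp (-Real.pi / ((h ^ 2 / Real.pi : ℝ) : ℂ) *
        (n + Complex.I * ((h ^ 2 * α + Complex.I * s * h) / Real.pi)) ^ 2) := by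
    intro n
    rw [hpre, ← Complex.exp_add, ← Complex.exp_add]
    congr 1
    push_cast
    field_simp
    have hI3 : Complex.I ^ 3 = -Complex.I := Complex.I_pow_three
    have hI4 : Complex.I ^ 4 = 1 := Complex.I_pow_four
    ring_nf
    simp only [Complex.I_sq, hI3, hI4]
    ring
  simp_rw [h1, h2]
  rw [tsum_mul_left, tsum_mul_left, key]
  push_cast
  field_simp

lemma integral_Ioi_cexp_eq (hz : 0 < z.im) (t : ℝ) :
    ∫ s in Ioi (0 : ℝ), Complex.exp (2 * Complex.I * (z + t) * s) =
      Complex.I / (2 * (z + t)) := by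
  have hne : z + t ≠ 0 := by
    intro h0
    have := congrArg Complex.im h0
    simp at this
    linarith
  rw [integral_exp_mul_complex_Ioi (by simpa using hz)]
  simp
  field_simp
  simp

lemma norm_cexp_two_I_mul (t s : ℝ) :
    ‖Complex.exp (2 * Complex.I * (z + t) * s)‖ = Real.exp (-(2 * z.im) * s) := by
  rw [Complex.norm_exp]
  congr 1
  simp

lemma hasSum_trapezoid_integral (h_pos : 0 < h) (hz : 0 < z.im) (α : ℝ) :
    HasSum (fun k : ℤ => Complex.exp (-((((k : ℝ) - α) * h : ℝ) : ℂ) ^ 2) *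
        (Complex.I / (2 * (z + ((((k : ℝ) - α) * h : ℝ) : ℂ)))))
      (∫ s in Ioi (0 : ℝ), ∑' k : ℤ, Complex.exp (-((((k : ℝ) - α) * h : ℝ) : ℂ) ^ 2) *
        Complex.exp (2 * Complex.I * (z + ((((k : ℝ) - α) * h : ℝ) : ℂ)) * s)) := by
  have hi := (integrableOn_exp_mul_Ioi (a := -(2 * z.im)) (by linarith) 0)
  have hnorm : ∀ (k : ℤ) (s : ℝ), ‖Complex.exp (-((((k : ℝ) - α) * h : ℝ) : ℂ) ^ 2) *
        Complex.exp (2 * Complex.I * (z + ((((k : ℝ) - α) * h : ℝ) : ℂ)) * s)‖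
      = Real.exp (-(((k : ℝ) - α) * h) ^ 2) * Real.exp (-(2 * z.im) * s) := by
    intro k s
    rw [norm_mul, norm_cexp_two_I_mul, ← Complex.ofReal_pow, ← Complex.ofReal_neg,
      Complex.norm_exp_ofReal]
  have key := hasSum_integral_of_summable_integral_norm (μ := volume.restrict (Ioi (0 : ℝ)))
    (F := fun (k : ℤ) (s : ℝ) => Complex.exp (-((((k : ℝ) - α) * h : ℝ) : ℂ) ^ 2) *
        Complex.exp (2 * Complex.I * (z + ((((k : ℝ) - α) * h : ℝ) : ℂ)) * s)) ?_ ?_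
  · refine key.congr_fun fun k => ?_
    rw [integral_const_mul, integral_Ioi_cexp_eq hz]
  · intro k
    refine Integrable.mono' (hi.const_mul (Real.exp (-(((k : ℝ) - α) * h) ^ 2))) (by fun_prop)
      (ae_of_all _ fun s => (hnorm k s).le)
  · simp only [hnorm, integral_const_mul]
    exact (summable_exp_neg_sq_shift h_pos α).mul_right _

lemma summable_int_exp_neg_abs {c : ℝ} (hc : 0 < c) :
    Summable fun n : ℤ => Real.exp (-(c * |(n : ℝ)|)) := by
  have hg : Summable fun n : ℕ => Real.exp (-(c * n)) := by
    have := summable_geometric_of_lt_one (Real.exp_pos (-c)).le (Real.exp_lt_one_iff.2 (by linarith : -c < 0))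
    refine this.congr fun n => ?_
    rw [← Real.exp_nat_mul]
    congr 1
    ring
  refine summable_int_iff_summable_nat_and_neg.2 ⟨?_, ?_⟩ <;> simpa using hg

lemma faddeeva_sub_mul_exp (z : ℂ) (b : ℝ) :
    ∫ s in Ioi (0 : ℝ), Complex.exp (2 * Complex.I * z * s) *
        Complex.exp (-((s : ℂ) - b) ^ 2) =
      √Real.pi / 2 * (Complex.exp (-(b : ℂ) ^ 2) * faddeeva (z - b * Complex.I)) := by
  have hpi : (√Real.pi : ℂ) ≠ 0 := by exact_mod_cast (Real.sqrt_pos.2 Real.pi_pos).ne'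
  have h1 : ∀ s : ℝ, Complex.exp (2 * Complex.I * z * s) * Complex.exp (-((s : ℂ) - b) ^ 2)
      = Complex.exp (-(b : ℂ) ^ 2) *
        Complex.exp (-(s : ℂ) ^ 2 + 2 * Complex.I * (z - b * Complex.I) * s) := by
    intro s
    rw [← Complex.exp_add, ← Complex.exp_add]
    congr 1
    linear_combination (-2 * b * s : ℂ) * Complex.I_sq * (-1)
  simp_rw [h1]
  rw [integral_const_mul, faddeeva_eq_integral]
  field_simp

/-- Termwise integration of the dual series: each shifted Gaussian integrates to a vertically
shifted `w`. -/
lemma hasSum_modes (h_pos : 0 < h) (hz : 0 < z.im) (α : ℝ) :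
    HasSum (fun n : ℤ => √Real.pi / 2 * (Complex.exp (-2 * Real.pi * Complex.I * n * α) *
        (Complex.exp (-((Real.pi / h * n : ℝ) : ℂ) ^ 2) *
          faddeeva (z - (Real.pi / h * n : ℝ) * Complex.I))))
      (∫ s in Ioi (0 : ℝ), ∑' n : ℤ, Complex.exp (-2 * Real.pi * Complex.I * n * α) *
        (Complex.exp (2 * Complex.I * z * s) *
          Complex.exp (-((s : ℂ) - (Real.pi / h * n : ℝ)) ^ 2))) := by
  set y := z.im
  set a := Real.pi / h with ha
  have ha0 : 0 < a := by positivity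
  have hnorm : ∀ (n : ℤ) (s : ℝ), ‖Complex.exp (-2 * Real.pi * Complex.I * n * α) *
        (Complex.exp (2 * Complex.I * z * s) * Complex.exp (-((s : ℂ) - (a * n : ℝ)) ^ 2))‖
      = Real.exp (-(2 * y) * s) * Real.exp (-(s - a * n) ^ 2) := by
    intro n s
    have h1 := norm_cexp_two_I_mul (z := z) 0 s
    rw [Complex.ofReal_zero, add_zero] at h1
    have h2 : ‖Complex.exp (-2 * Real.pi * Complex.I * n * α)‖ = 1 := by
      rw [show -2 * (Real.pi : ℂ) * Complex.I * n * α = ((-2 * Real.pi * n * α : ℝ) : ℂ) * Complex.I by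
        push_cast; ring]
      exact Complex.norm_exp_ofReal_mul_I _
    rw [norm_mul, norm_mul, h1, h2, one_mul, ← Complex.ofReal_sub, ← Complex.ofReal_pow,
      ← Complex.ofReal_neg, Complex.norm_exp_ofReal]
  -- From `(s - an)² ≥ y|s - an| - y²/4` and `|s - an| ≥ a|n| - s`: half of the decay `e^{-2ys}` is
  -- given up to gain summability in `n`.
  have hle : ∀ (n : ℤ) (s : ℝ), 0 < s →
      Real.exp (-(2 * y) * s) * Real.exp (-(s - a * n) ^ 2) ≤
      Real.exp (y ^ 2 / 4) * Real.exp (-(y * a * |(n : ℝ)|)) * Real.exp (-y * s) := by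
    intro n s hs
    rw [← Real.exp_add, ← Real.exp_add, ← Real.exp_add, Real.exp_le_exp]
    have h1 : a * |(n : ℝ)| - s ≤ |s - a * n| := by
      have := abs_sub_abs_le_abs_sub (a * n) s
      rw [abs_mul, abs_of_pos ha0, abs_of_pos hs, abs_sub_comm] at this
      exact this
    have h2 := sq_nonneg (|s - a * n| - y / 2)
    have h3 := mul_le_mul_of_nonneg_left h1 hz.le
    have h4 := sq_abs (s - a * n)
    nlinarith
  have hi := (integrableOn_exp_mul_Ioi (a := -y) (by simpa using hz) 0)
  have hint : ∀ n : ℤ, IntegrableOn (fun s : ℝ =>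
      Complex.exp (-2 * Real.pi * Complex.I * n * α) * (Complex.exp (2 * Complex.I * z * s) *
        Complex.exp (-((s : ℂ) - (a * n : ℝ)) ^ 2))) (Ioi 0) := by
    intro n
    refine Integrable.mono' (hi.const_mul
      (Real.exp (y ^ 2 / 4) * Real.exp (-(y * a * |(n : ℝ)|)))) (by fun_prop) ?_
    filter_upwards [ae_restrict_mem measurableSet_Ioi] with s hs
    rw [hnorm]
    exact hle n s hs
  have key := hasSum_integral_of_summable_integral_norm (μ := volume.restrict (Ioi (0 : ℝ)))
    (F := fun (n : ℤ) (s : ℝ) => Complex.exp (-2 * Real.pi * Complex.I * n * α) *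
        (Complex.exp (2 * Complex.I * z * s) *
          Complex.exp (-((s : ℂ) - (a * n : ℝ)) ^ 2))) hint ?_
  · refine key.congr_fun fun n => ?_
    rw [integral_const_mul, faddeeva_sub_mul_exp]
    ring
  · refine Summable.of_nonneg_of_le (fun n => integral_nonneg fun s => norm_nonneg _) (fun n => ?_)
      (((summable_int_exp_neg_abs (mul_pos hz ha0)).mul_left (Real.exp (y ^ 2 / 4))).mul_right
        (∫ s in Ioi (0 : ℝ), Real.exp (-y * s)))
    rw [← integral_const_mul]
    refine setIntegral_mono_on (hint n).norm (hi.const_mul _) measurableSet_Ioi fun s hs => ?_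
    rw [hnorm]
    exact hle n s hs

lemma integral_modes_eq (h_pos : 0 < h) (α : ℝ) :
    h * ∫ s in Ioi (0 : ℝ), ∑' k : ℤ, Complex.exp (-((((k : ℝ) - α) * h : ℝ) : ℂ) ^ 2) *
        Complex.exp (2 * Complex.I * (z + ((((k : ℝ) - α) * h : ℝ) : ℂ)) * s) =
      √Real.pi * ∫ s in Ioi (0 : ℝ), ∑' n : ℤ, Complex.exp (-2 * Real.pi * Complex.I * n * α) *
        (Complex.exp (2 * Complex.I * z * s) *
          Complex.exp (-((s : ℂ) - (Real.pi / h * n : ℝ)) ^ 2)) := by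
  rw [← integral_const_mul, ← integral_const_mul]
  congr 1
  ext s
  have key := tsum_cexp_shift_eq h_pos α s
  have h1 : ∀ k : ℤ, Complex.exp (-((((k : ℝ) - α) * h : ℝ) : ℂ) ^ 2) *
        Complex.exp (2 * Complex.I * (z + ((((k : ℝ) - α) * h : ℝ) : ℂ)) * s)
      = Complex.exp (2 * Complex.I * z * s) *
        Complex.exp (-((((k : ℝ) - α) * h : ℝ) : ℂ) ^ 2 +
        2 * Complex.I * ((((k : ℝ) - α) * h : ℝ) : ℂ) * s) := by
    intro k
    rw [← Complex.exp_add, ← Complex.exp_add]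
    congr 1
    ring
  have h2 : ∀ n : ℤ, Complex.exp (-2 * Real.pi * Complex.I * n * α) *
        (Complex.exp (2 * Complex.I * z * s) *
          Complex.exp (-((s : ℂ) - (Real.pi / h * n : ℝ)) ^ 2))
      = Complex.exp (2 * Complex.I * z * s) * (Complex.exp (-2 * Real.pi * Complex.I * n * α) *
        Complex.exp (-((s : ℂ) - (Real.pi / h : ℝ) * n) ^ 2)) := by
    intro n
    push_cast
    ring
  simp_rw [h1, h2]
  rw [tsum_mul_left, tsum_mul_left, mul_left_comm, key]
  ring

/-- The Fourier modes of the trapezoidal sum of `f_z`. -/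
noncomputable def trapMode (h α : ℝ) (z : ℂ) (n : ℤ) : ℂ :=
  ((Real.cos (2 * Real.pi * n * α) * Real.exp (-(Real.pi / h * n) ^ 2) : ℝ) : ℂ) *
    faddeeva (z - (Real.pi / h * n : ℝ) * Complex.I)

lemma hasSum_trapMode (h_pos : 0 < h) (hz : 0 < z.im) (α : ℝ) :
    HasSum (trapMode h α z) (trapRule h α (faddeevaIntegrand z)) := by
  have hpi : (Real.pi : ℂ) ≠ 0 := by exact_mod_cast Real.pi_ne_zero
  have hsq : (√Real.pi : ℂ) * √Real.pi = Real.pi := by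
    exact_mod_cast Real.mul_self_sqrt Real.pi_pos.le
  have e1 := hasSum_trapezoid_integral h_pos hz α
  have e2 := (hasSum_trapezoid_integral h_pos hz (-α))
  -- Replacing `k` by `-k` in the sum for `-α` sends its nodes to the negatives of those for `α`,
  -- supplying the `1/(z - t)` half of the partial fractions. Averaging over `±α` produces the
  -- cosine.
  rw [← (Equiv.neg ℤ).hasSum_iff] at e2
  have e3 := (e1.add e2).mul_left (h / (Real.pi : ℂ))
  have m3 := ((hasSum_modes h_pos hz α).add (hasSum_modes h_pos hz (-α))).mul_left
    (√Real.pi / (Real.pi : ℂ))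
  have hval : ∀ A B A' B' : ℂ, h * A = √Real.pi * A' → h * B = √Real.pi * B' →
      h / (Real.pi : ℂ) * (A + B) = √Real.pi / (Real.pi : ℂ) * (A' + B') := by
    intro A B A' B' hA hB
    field_simp
    linear_combination hA + hB
  rw [hval _ _ _ _ (integral_modes_eq h_pos α) (integral_modes_eq h_pos (-α))] at e3
  have e4 : HasSum (fun k : ℤ => (h : ℂ) * faddeevaIntegrand z ((((k : ℝ) - α) * h : ℝ) : ℂ)) _ :=
    e3.congr_fun fun k => by
      have hne1 : z + ((((k : ℝ) - α) * h : ℝ) : ℂ) ≠ 0 := fun h0 => by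
        have := congrArg Complex.im h0
        rw [Complex.add_im, Complex.ofReal_im, add_zero] at this
        exact hz.ne' this
      have hne2 : z - ((((k : ℝ) - α) * h : ℝ) : ℂ) ≠ 0 := fun h0 => by
        have := congrArg Complex.im h0
        rw [Complex.sub_im, Complex.ofReal_im, sub_zero] at this
        exact hz.ne' this
      have hneg : (((((Equiv.neg ℤ) k : ℤ) : ℝ) - -α) * h : ℝ) = -(((k : ℝ) - α) * h) := by
        simp
        ring
      simp only [Function.comp, hneg]
      rw [faddeevaIntegrand]
      generalize ((((k : ℝ) - α) * h : ℝ)) = t at *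
      have hne3 : z ^ 2 - (t : ℂ) ^ 2 ≠ 0 := by
        rw [sq_sub_sq]
        exact mul_ne_zero hne1 hne2
      have hne4 : z + ((-t : ℝ) : ℂ) ≠ 0 := by
        simpa [sub_eq_add_neg] using hne2
      push_cast at *
      rw [neg_sq]
      field_simp
      ring
  rw [trapRule, ← tsum_mul_left, e4.tsum_eq]
  refine m3.congr_fun fun n => ?_
  rw [trapMode]
  have hcos : ((Real.cos (2 * Real.pi * n * α) : ℝ) : ℂ) =
      (Complex.exp (-2 * Real.pi * Complex.I * n * α) +
        Complex.exp (-2 * Real.pi * Complex.I * n * (-α : ℝ))) / 2 := by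
    rw [Complex.ofReal_cos, Complex.cos, add_comm]
    push_cast
    congr 3 <;> ring
  rw [Complex.ofReal_mul, hcos]
  push_cast
  field_simp
  ring_nf
  simp only [pow_two, hsq]
  ring

end Poisson

/-! ### Poles and residues of the integrand -/

section Poles

variable {z : ℂ}

lemma ne_zero_of_im_pos (hz : 0 < z.im) : z ≠ 0 := by
  rintro rfl
  simp at hz

/-- The regular part of `f_z` at its pole `p ∈ {z, -z}`. -/
lemma faddeevaIntegrand_eq {p : ℂ} (hp : p ^ 2 = z ^ 2) (t : ℂ) :
    faddeevaIntegrand z t = (t - p) ^ (-1 : ℤ) *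
      (-(Complex.exp (-t ^ 2) * (Complex.I * z / (Real.pi * (p + t))))) := by
  rw [faddeevaIntegrand, ← hp, sq_sub_sq, zpow_neg_one, ← neg_sub p t, inv_neg]
  simp only [div_eq_mul_inv, mul_inv]
  ring

lemma analyticAt_regularPart {p : ℂ} (hp0 : p ≠ 0) :
    AnalyticAt ℂ (fun t => -(Complex.exp (-t ^ 2) * (Complex.I * z / (Real.pi * (p + t))))) p := by
  have hpi : (Real.pi : ℂ) ≠ 0 := by exact_mod_cast Real.pi_ne_zero
  have hne : (Real.pi : ℂ) * (p + p) ≠ 0 := by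
    rw [← two_mul]
    exact mul_ne_zero hpi (mul_ne_zero two_ne_zero hp0)
  fun_prop (disch := exact hne)

lemma meromorphicAt_faddeevaIntegrand (z t : ℂ) : MeromorphicAt (faddeevaIntegrand z) t := by
  unfold faddeevaIntegrand
  fun_prop

lemma order_faddeevaIntegrand_neg {p : ℂ} (hz : z ≠ 0) (hp : p ^ 2 = z ^ 2) :
    meromorphicOrderAt (faddeevaIntegrand z) p < 0 := by
  have hp0 : p ≠ 0 := by
    rintro rfl
    exact hz (by simpa using hp.symm)
  have hpi : (Real.pi : ℂ) ≠ 0 := by exact_mod_cast Real.pi_ne_zero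
  have : meromorphicOrderAt (faddeevaIntegrand z) p = ((-1 : ℤ) : WithTop ℤ) := by
    rw [meromorphicOrderAt_eq_int_iff (meromorphicAt_faddeevaIntegrand z p)]
    refine ⟨_, analyticAt_regularPart (z := z) hp0, ?_,
      Eventually.of_forall fun t => faddeevaIntegrand_eq hp t⟩
    rw [← two_mul]
    simp [Complex.exp_ne_zero, hz, hp0]
  rw [this]
  exact_mod_cast (by norm_num : (-1 : ℤ) < 0)

lemma order_faddeevaIntegrand_nonneg {t : ℂ} (ht : t ^ 2 ≠ z ^ 2) :
    0 ≤ meromorphicOrderAt (faddeevaIntegrand z) t := by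
  have hpi : (Real.pi : ℂ) ≠ 0 := by exact_mod_cast Real.pi_ne_zero
  have hne : (Real.pi : ℂ) * (z ^ 2 - t ^ 2) ≠ 0 := mul_ne_zero hpi (sub_ne_zero.2 ht.symm)
  apply AnalyticAt.meromorphicOrderAt_nonneg
  unfold faddeevaIntegrand
  fun_prop (disch := exact hne)

lemma stripPoles_faddeevaIntegrand {H : ℝ} (hz : 0 < z.im) (hH : z.im < H) :
    stripPoles H (faddeevaIntegrand z) = {z, -z} := by
  ext p
  simp only [stripPoles, mem_ofPred_eq, mem_insert_iff, mem_singleton_iff]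
  constructor
  · rintro ⟨-, -, hlt⟩
    by_contra hcon
    exact absurd (order_faddeevaIntegrand_nonneg fun h => hcon (sq_eq_sq_iff_eq_or_eq_neg.1 h))
      (not_le.2 hlt)
  · intro hp
    refine ⟨?_, meromorphicAt_faddeevaIntegrand z p,
      order_faddeevaIntegrand_neg (ne_zero_of_im_pos hz) (sq_eq_sq_iff_eq_or_eq_neg.2 hp)⟩
    rcases hp with rfl | rfl
    · rwa [abs_of_pos hz]
    · rwa [Complex.neg_im, abs_neg, abs_of_pos hz]

lemma simpleResidue_faddeevaIntegrand {p : ℂ} (hz : z ≠ 0) (hp : p ^ 2 = z ^ 2) :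
    simpleResidue (faddeevaIntegrand z) p =
      -(Complex.exp (-z ^ 2) * (Complex.I * z / (Real.pi * (p + p)))) := by
  have hp0 : p ≠ 0 := by
    rintro rfl
    exact hz (by simpa using hp.symm)
  rw [simpleResidue, ← hp]
  refine Tendsto.limUnder_eq ?_
  refine ((analyticAt_regularPart (z := z) hp0).continuousAt.tendsto.mono_left
    nhdsWithin_le_nhds).congr' ?_
  filter_upwards [self_mem_nhdsWithin] with t ht
  have : t - p ≠ 0 := sub_ne_zero.2 ht
  rw [faddeevaIntegrand_eq hp, zpow_neg_one, mul_inv_cancel_left₀ this]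

end Poles

/-! ### The correction term -/

section Correction

variable {h : ℝ} {z : ℂ}

lemma norm_q_lt_one (h_pos : 0 < h) (hz : 0 < z.im) (α : ℝ) :
    ‖Complex.exp (2 * Real.pi * Complex.I * (α + z / h))‖ < 1 := by
  rw [Complex.norm_exp, Real.exp_lt_one_iff]
  have : (2 * Real.pi * Complex.I * (α + z / h)).re = -(2 * Real.pi * (z.im / h)) := by
    rw [show 2 * (Real.pi : ℂ) * Complex.I * (α + z / h)
      = ((2 * Real.pi : ℝ) : ℂ) * (Complex.I * (α + z / h)) by push_cast; ring,
      Complex.re_ofReal_mul, Complex.I_mul_re, Complex.add_im, Complex.ofReal_im,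
      Complex.div_ofReal_im]
    ring
  rw [this, neg_lt_zero]
  positivity

/-- With `q = e^{2πi(α + z/h)}`, `1 - g(z) = -2q/(1 - q)`, and `|q| < 1` in the upper half-plane. -/
lemma hasSum_one_sub_cotKernel (h_pos : 0 < h) (hz : 0 < z.im) (α : ℝ) :
    HasSum (fun n : ℕ => -2 * Complex.exp (2 * Real.pi * Complex.I * (α + z / h)) ^ (n + 1))
      (1 - cotKernel h α z) := by
  have hq := norm_q_lt_one h_pos hz α
  have hpi : (Real.pi : ℂ) ≠ 0 := by exact_mod_cast Real.pi_ne_zero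
  have him : 0 < ((α : ℂ) + z / h).im := by
    rw [Complex.add_im, Complex.ofReal_im, Complex.div_ofReal_im, zero_add]
    positivity
  have hcot := pi_mul_cot_pi_q_exp ⟨(α : ℂ) + z / h, him⟩
  simp only at hcot
  set q := Complex.exp (2 * Real.pi * Complex.I * (α + z / h)) with hqdef
  have hs := hasSum_geometric_of_norm_lt_one hq
  rw [hs.tsum_eq] at hcot
  have hq1 : 1 - q ≠ 0 := by
    intro h0
    rw [← sub_eq_zero.1 h0, norm_one] at hq
    exact lt_irrefl _ hq
  have h1 : HasSum (fun n : ℕ => -2 * q ^ (n + 1)) (-2 * q * (1 - q)⁻¹) := by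
    refine (hs.mul_left (-2 * q)).congr_fun fun n => ?_
    ring
  convert h1 using 1
  rw [cotKernel]
  have h2 : Complex.cot (Real.pi * (α + z / h)) = Complex.I - 2 * Complex.I * (1 - q)⁻¹ := by
    apply mul_left_cancel₀ hpi
    rw [hcot]
    ring
  rw [h2]
  field_simp
  linear_combination (1 + q) * Complex.I_sq

lemma cotKernel_neg (h α : ℝ) (z : ℂ) : cotKernel h α (-z) = -cotKernel h (-α) z := by
  have harg : (Real.pi : ℂ) * (α + -z / h) = -(Real.pi * ((-α : ℝ) + z / h)) := by
    push_cast
    ring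
  rw [cotKernel, cotKernel, harg, Complex.cot, Complex.cot, Complex.cos_neg, Complex.sin_neg,
    div_neg, mul_neg]

/-- The residues at `±z` are `∓ i e^{-z²}/(2π)`; oddness of the cotangent moves the pole at `-z` to
`z` with `α` replaced by `-α`. -/
lemma trapCorrection_faddeevaIntegrand {H : ℝ} (α : ℝ) (hz : 0 < z.im) (hH : z.im < H) :
    trapCorrection h α H (faddeevaIntegrand z) = Complex.exp (-z ^ 2) / 2 *
      ((1 - cotKernel h α z) + (1 - cotKernel h (-α) z)) := by
  have hz0 := ne_zero_of_im_pos hz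
  have hpi : (Real.pi : ℂ) ≠ 0 := by exact_mod_cast Real.pi_ne_zero
  have hne : z ≠ -z := fun h0 => hz0 (self_eq_neg.1 h0)
  rw [trapCorrection, stripPoles_faddeevaIntegrand hz hH, finsum_mem_pair hne,
    simpleResidue_faddeevaIntegrand hz0 rfl, simpleResidue_faddeevaIntegrand hz0 (neg_sq z),
    cotKernel_neg, Real.sign_of_pos hz, Real.sign_of_neg (by simpa using hz)]
  push_cast
  rw [← neg_add, ← two_mul]
  field_simp
  linear_combination (-2 + cotKernel h α z + cotKernel h (-α) z) * Complex.I_sq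

lemma hasSum_trapCorrection {H : ℝ} (h_pos : 0 < h) (α : ℝ) (hz : 0 < z.im) (hH : z.im < H) :
    HasSum (fun n : ℕ => -2 * ((Real.cos (2 * Real.pi * (n + 1) * α) : ℝ) : ℂ) *
        (Complex.exp (-z ^ 2) * Complex.exp (2 * Complex.I * (Real.pi * (n + 1) / h : ℝ) * z)))
      (trapCorrection h α H (faddeevaIntegrand z)) := by
  rw [trapCorrection_faddeevaIntegrand α hz hH]
  refine (((hasSum_one_sub_cotKernel h_pos hz α).add
    (hasSum_one_sub_cotKernel h_pos hz (-α))).mul_left _).congr_fun fun n => ?_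
  have hq : ∀ β : ℝ, Complex.exp (2 * Real.pi * Complex.I * (β + z / h)) ^ (n + 1)
      = Complex.exp (2 * Real.pi * (n + 1) * β * Complex.I) *
        Complex.exp (2 * Complex.I * (Real.pi * (n + 1) / h : ℝ) * z) := by
    intro β
    rw [← Complex.exp_nat_mul, ← Complex.exp_add]
    congr 1
    push_cast
    ring
  rw [hq, hq, Complex.ofReal_cos, Complex.cos]
  push_cast
  rw [show -(2 * (Real.pi : ℂ) * (n + 1) * α) * Complex.I
    = 2 * Real.pi * (n + 1) * -α * Complex.I by ring]
  ring

/-- The modes `±n` are paired. For `b = πn/h > 0`, reflecting `w(z - ib)` releases `2e^{-b²}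
e^{-(z-ib)²} = 2e^{-z²} e^{2ibz}`, which is the negative of the `n`-th correction term up to the
common cosine. -/
lemma modTrapRule_eq {H : ℝ} (h_pos : 0 < h) (α : ℝ) (hz : 0 < z.im) (hH : z.im < H) :
    modTrapRule h α H (faddeevaIntegrand z) = modTrapFaddeeva h α z := by
  have hm := hasSum_trapMode h_pos hz α
  have hinj1 : Function.Injective (fun n : ℕ => ((n : ℤ) + 1)) := fun a b hab => by
    simpa using hab
  have hinj2 : Function.Injective (fun n : ℕ => (-((n : ℤ) + 1))) := fun a b hab => by
    simpa using hab
  have hs1 : Summable fun n : ℕ => trapMode h α z ((n : ℤ) + 1) :=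
    hm.summable.comp_injective hinj1
  have hs2 : Summable fun n : ℕ => trapMode h α z (-((n : ℤ) + 1)) :=
    hm.summable.comp_injective hinj2
  have hc := hasSum_trapCorrection h_pos α hz hH
  have h0 : trapMode h α z 0 = faddeeva z := by simp [trapMode]
  have hsum := tsum_of_add_one_of_neg_add_one hs1 hs2
  rw [hm.tsum_eq, h0] at hsum
  rw [modTrapRule, modTrapFaddeeva, hsum]
  have hterm : ∀ n : ℕ, modTrapErrorTerm h α n z = trapMode h α z ((n : ℤ) + 1) +
      trapMode h α z (-((n : ℤ) + 1)) +
      -2 * ((Real.cos (2 * Real.pi * (n + 1) * α) : ℝ) : ℂ) *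
        (Complex.exp (-z ^ 2) * Complex.exp (2 * Complex.I * (Real.pi * (n + 1) / h : ℝ) * z)) := by
    intro n
    rw [modTrapErrorTerm, trapMode, trapMode]
    set b : ℝ := Real.pi * (n + 1) / h with hb
    have hb1 : Real.pi / h * (((n : ℤ) + 1 : ℤ) : ℝ) = b := by
      push_cast
      rw [hb]
      ring
    have hb2 : Real.pi / h * ((-((n : ℤ) + 1) : ℤ) : ℝ) = -b := by
      push_cast
      rw [hb]
      ring
    have hc2 : Real.cos (2 * Real.pi * ((-((n : ℤ) + 1) : ℤ) : ℝ) * α)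
        = Real.cos (2 * Real.pi * (n + 1) * α) := by
      rw [← Real.cos_neg]
      congr 1
      push_cast
      ring
    have hc1 : Real.cos (2 * Real.pi * (((n : ℤ) + 1 : ℤ) : ℝ) * α)
        = Real.cos (2 * Real.pi * (n + 1) * α) := by
      push_cast
      rfl
    have hrefl := faddeeva_add_faddeeva_neg (z - b * Complex.I)
    rw [neg_sub] at hrefl
    have hexp : Complex.exp (-(b : ℂ) ^ 2) * Complex.exp (-(z - b * Complex.I) ^ 2)
        = Complex.exp (-z ^ 2) * Complex.exp (2 * Complex.I * b * z) := by
      rw [← Complex.exp_add, ← Complex.exp_add]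
      congr 1
      linear_combination (-(b : ℂ) ^ 2) * Complex.I_sq
    rw [hb1, hb2, hc1, hc2, eq_sub_of_add_eq hrefl, neg_sq]
    push_cast
    rw [neg_mul, sub_neg_eq_add]
    linear_combination (-2 * Complex.cos (2 * Real.pi * (n + 1) * α)) * hexp
  rw [(((hs1.hasSum.add hs2.hasSum).add hc).congr_fun hterm).tsum_eq]
  ring

end Correction

/-! ### Existence of the continuation and the error bounds -/

theorem isModTrapFaddeeva_modTrapFaddeeva {h : ℝ} (h_pos : 0 < h) (h_lt : h < √2 * Real.pi)
    (α : ℝ) : IsModTrapFaddeeva h α (modTrapFaddeeva h α) := by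
  refine ⟨differentiable_modTrapFaddeeva h_pos h_lt α, fun z hz => ?_⟩
  -- The rule no longer depends on `H` once `H > Im z`, when both poles `±z` lie in the strip.
  refine tendsto_const_nhds.congr' ?_
  filter_upwards [eventually_gt_atTop z.im] with H hH
  exact (modTrapRule_eq h_pos α hz hH).symm

theorem mainTheorem4 (h α : ℝ) (h_pos : 0 < h) (h_lt : h < Real.sqrt 2 * Real.pi)
    (hα : α ∈ Set.Ico (0 : ℝ) 1) :
    ∃ J : ℂ → ℂ, IsModTrapFaddeeva h α J ∧
      ∀ z : ℂ, 0 ≤ z.im → z.im ≤ z.re →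
        ‖faddeeva z - J z‖ ≤ cAbs * trapErrFactor h ∧
        faddeeva z ≠ 0 ∧
        ‖faddeeva z - J z‖ / ‖faddeeva z‖ ≤ cRel / h * trapErrFactor h := by
  refine ⟨modTrapFaddeeva h α, isModTrapFaddeeva_modTrapFaddeeva h_pos h_lt α,
    fun z hy hyx => ?_⟩
  have hF := trapErrFactor_nonneg h_pos h_lt
  have hw := faddeeva_ne_zero hy hyx
  refine ⟨?_, hw, ?_⟩
  · refine (norm_modTrapFaddeeva_sub_le h_pos h_lt α (by norm_num : (0 : ℝ) ≤ 4)
      fun b hb hb0 => (norm_faddeeva_sub_le hb hb0 hy hyx).1).trans ?_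
    gcongr
    exact four_le_cAbs
  · have hx : 0 ≤ z.re := hy.trans hyx
    have hp : 0 < √Real.pi * (z.re + 3 / 5) := by positivity
    have hE := norm_modTrapFaddeeva_sub_le h_pos h_lt α
      (by positivity : 0 ≤ 9.27 / (√Real.pi * (z.re + 3 / 5)))
      fun b hb hb0 => (le_div_iff₀ hp).2 (norm_faddeeva_sub_le hb hb0 hy hyx).2
    have hlow := one_le_mul_norm_faddeeva hy hyx
    rw [div_le_iff₀ (norm_pos_iff.2 hw)]
    refine hE.trans ?_
    -- The factor `√π (x + 3/5)` in the mode bound cancels against the one in the lower bound for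
    -- `|w|`.
    calc 9.27 / (√Real.pi * (z.re + 3 / 5)) * trapErrFactor h
        ≤ 9.27 / (√Real.pi * (z.re + 3 / 5)) * trapErrFactor h *
          (√2 * (√Real.pi * (z.re + 3 / 5)) * ‖faddeeva z‖) :=
          le_mul_of_one_le_right (by positivity) hlow
      _ = √2 * 9.27 * trapErrFactor h * ‖faddeeva z‖ := by
          field_simp
      _ ≤ _ := by
          gcongr
          exact mul_le_cRel_div h_pos h_lt
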